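/- Let $d,m\ge 0$ be integers, let $H$ be a subgroup of $GL(d,\mathbb R)$, and let $G=H\ltimes\mathbb R^d$ act on $\mathbb R^d$ by $(A,b)\cdot x=Ax+b$ and on the space $\mathfrak X$ of smooth vector fields of $\mathbb R^d$ by $((A,b)\cdot f)(x)=A\,f(A^{-1}(x-b))$. Put $E=F=M=\mathbb R^d$, with $H$ acting by matrix-vector multiplication, let $\mathrm{Sym}\,M^*=\bigoplus_{j\ge0}\mathrm{Sym}^jM^*$ (algebraic direct sum), and let $H$ act on all tensor constructions by the tensor product action. An $m$-linear map $\varphi:\mathfrak X^m\to\mathfrak X$ is called local if $\operatorname{supp}\varphi(f_1,\dots,f_m)\subset\operatorname{supp} f_i$ for all $f_1,\dots,f_m$ and all $i$ (equivalently, $\varphi(f_1,\dots,f_m)(x)$ depends only on the germs of the $f_i$ at $x$), and $G$-equivariant if $\varphi(g\cdot f_1,\dots,g\cdot f_m)=g\cdot\varphi(f_1,\dots,f_m)$ for all $g\in G$. Let $\mathcal L$ be the vector space of local $G$-equivariant symmetric $m$-linear maps $\mathfrak X^m\to\mathfrak X$. Let $\mathrm{Lin}_H(\mathrm{Sym}^m(E\otimes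 \mathrm{Sym}\,M^*),F)$ be the space of $H$-equivariant linear maps, and let $\mathrm{Lin}_H^{\mathrm{fin}}$ be its subspace of maps of finite order, i.e. those that factor, for some $k$, through $\mathrm{Sym}^m$ of the projection $E\otimes\mathrm{Sym}\,M^*\to E\otimes\bigoplus_{j\le k}\mathrm{Sym}^jM^*$. A composition is a finitely supported map $\kappa:\mathbb N\to\mathbb N$, with size $|\kappa|=\sum_j\kappa(j)$; put $$\mathrm{Sym}_\kappa=F\otimes\bigotimes_{j\ge0}\mathrm{Sym}^{\kappa(j)}\bigl(E^*\otimes\mathrm{Sym}^jM\bigr),$$ and let $\mathrm{Sym}_\kappa^H$ be the subspace of $H$-invariant elements. Then: 1. Every $\varphi\in\mathcal L$ is continuous for the Fréchet ($C^\infty$) topology of $\mathfrak X$. 2. There is a linear bijection $J:\mathcal L\to \mathrm{Lin}_H^{\mathrm{fin}}(\mathrm{Sym}^m(E\otimes \mathrm{Sym}\,M^*),F)$ such that for every $\varphi\in\mathcal L$ and all sufficiently large $k$ (depending on $\varphi$), $\varphi(f_1,\dots,f_m)(0)=J(\varphi)(j^kf_1\cdots j^kf_m)$ for all $f_1,\dots,f_m\in\mathfrak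 X$, where $j^kf=\sum_{j\le k}\frac1{j!}\sum_{\alpha_1,\dots,\alpha_j=1}^{d}\partial_{\alpha_1}\cdots\partial_{\alpha_j}f(0)\otimes dx_{\alpha_1}\cdots dx_{\alpha_j}\in E\otimes\mathrm{Sym}\,M^*$ is the Taylor expansion of order $k$ at $0$. 3. There is a linear bijection $$\mathrm{Lin}_H^{\mathrm{fin}}(\mathrm{Sym}^m(E\otimes \mathrm{Sym}\,M^*),F)\to\bigoplus_{|\kappa|=m}\mathrm{Sym}_\kappa^H$$ whose $\kappa$-component sends $L$ to the element of $\mathrm{Sym}_\kappa$ which represents the restriction of $L$ to the summand $\bigotimes_j\mathrm{Sym}^{\kappa(j)}(E\otimes\mathrm{Sym}^jM^*)$ of $\mathrm{Sym}^m(E\otimes\mathrm{Sym}\,M^*)$. Here $u\otimes a\in\mathrm{Sym}_\kappa$ represents the map $b\mapsto\langle a,b\rangle u$, where $\langle\cdot,\cdot\rangle$ is built multiplicatively from the evaluation pairing of a space with its dual, with $\langle v_1\cdots v_n,w_1\cdots w_n\rangle=\sum_{\sigma\in S_n}\prod_i\langle v_i,w_{\sigma(i)}\rangle$ on symmetric powers.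 4. By the same rule, the space $\mathrm{Lin}_H(\mathrm{Sym}^m(E\otimes \mathrm{Sym}\,M^*),F)$ of all $H$-equivariant linear maps is in linear bijection with the direct product $\prod_{|\kappa|=m}\mathrm{Sym}_\kappa^H$. -/

import Mathlib

open scoped TensorProduct DirectSum ContDiff

namespace LocalEquivariant

noncomputable section

section SymmetricPowers

/-- A symmetric multilinear map `V^n → N` descends to a linear map on the symmetric power. -/
def symLift {V N : Type*} [AddCommMonoid V] [Module ℝ V] [AddCommMonoid N] [Module ℝ N] {n : ℕ}
    (f : MultilinearMap ℝ (fun _ : Fin n => V) N)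
    (hf : ∀ (σ : Equiv.Perm (Fin n)) (v : Fin n → V), f (fun i => v (σ i)) = f v) :
    Sym[ℝ]^n V →ₗ[ℝ] N where
  toFun := AddCon.lift (addConGen (SymmetricPower.Rel ℝ (Fin n) V))
    (PiTensorProduct.lift f).toAddMonoidHom
    (AddCon.addConGen_le.2 (by
      rintro x y ⟨σ, v⟩
      simpa [AddCon.ker_rel] using (hf σ v).symm))
  map_add' x y := map_add _ x y
  map_smul' r x := by
    induction x using AddCon.induction_on with
    | H x => exact map_smul (PiTensorProduct.lift f) r x

@[simp] theorem symLift_tprod {V N : Type*} [AddCommMonoid V] [Module ℝ V] [AddCommMonoid N]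
    [Module ℝ N] {n : ℕ} (f : MultilinearMap ℝ (fun _ : Fin n => V) N)
    (hf : ∀ (σ : Equiv.Perm (Fin n)) (v : Fin n → V), f (fun i => v (σ i)) = f v)
    (v : Fin n → V) : symLift f hf (SymmetricPower.tprod ℝ v) = f v :=
  PiTensorProduct.lift.tprod v

theorem sym_ext {V N : Type*} [AddCommMonoid V] [Module ℝ V] [AddCommMonoid N] [Module ℝ N] {n : ℕ}
    {f g : Sym[ℝ]^n V →ₗ[ℝ] N}
    (h : ∀ v : Fin n → V, f (SymmetricPower.tprod ℝ v) = g (SymmetricPower.tprod ℝ v)) :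
    f = g :=
  LinearMap.ext_on_range (SymmetricPower.span_tprod_eq_top (R := ℝ) (ι := Fin n) (M := V)) h

/-- Functoriality of the symmetric power: `v₁ ⋯ vₙ ↦ f v₁ ⋯ f vₙ`. -/
def symMap {V W : Type*} [AddCommMonoid V] [Module ℝ V] [AddCommMonoid W] [Module ℝ W] (n : ℕ)
    (f : V →ₗ[ℝ] W) : Sym[ℝ]^n V →ₗ[ℝ] Sym[ℝ]^n W :=
  symLift ((SymmetricPower.tprod ℝ).compLinearMap fun _ => f)
    (fun σ v => SymmetricPower.tprod_equiv σ fun i => f (v i))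

@[simp] theorem symMap_tprod {V W : Type*} [AddCommMonoid V] [Module ℝ V] [AddCommMonoid W]
    [Module ℝ W] (n : ℕ) (f : V →ₗ[ℝ] W) (v : Fin n → V) :
    symMap n f (SymmetricPower.tprod ℝ v) = SymmetricPower.tprod ℝ fun i => f (v i) :=
  symLift_tprod _ _ v

/-- The pairing of tensor products `⨂ Vᵢ` and `⨂ Wᵢ` (finitely many factors) induced by pairings
of the factors: `⟨⨂ vᵢ, ⨂ wᵢ⟩ = ∏ ⟨vᵢ, wᵢ⟩`. -/
def tensorPairing {ι : Type*} [Fintype ι] {V W : ι → Type*} [∀ i, AddCommMonoid (V i)]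
    [∀ i, Module ℝ (V i)] [∀ i, AddCommMonoid (W i)] [∀ i, Module ℝ (W i)]
    (B : ∀ i, V i →ₗ[ℝ] W i →ₗ[ℝ] ℝ) :
    (⨂[ℝ] i, V i) →ₗ[ℝ] (⨂[ℝ] i, W i) →ₗ[ℝ] ℝ :=
  (PiTensorProduct.map₂ B).compr₂ (PiTensorProduct.lift (MultilinearMap.mkPiAlgebra ℝ ι ℝ))

theorem tensorPairing_tprod {ι : Type*} [Fintype ι] {V W : ι → Type*} [∀ i, AddCommMonoid (V i)]
    [∀ i, Module ℝ (V i)] [∀ i, AddCommMonoid (W i)] [∀ i, Module ℝ (W i)]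
    (B : ∀ i, V i →ₗ[ℝ] W i →ₗ[ℝ] ℝ) (v : ∀ i, V i) (w : ∀ i, W i) :
    tensorPairing B (PiTensorProduct.tprod ℝ v) (PiTensorProduct.tprod ℝ w)
      = ∏ i, B i (v i) (w i) := by
  simp [tensorPairing, PiTensorProduct.map₂_tprod_tprod]

/-- For fixed `v₁, …, vₙ`, the linear form `w₁ ⋯ wₙ ↦ ∑_σ ∏ᵢ ⟨vᵢ, w_{σ i}⟩` on `Sym^n W`. -/
def symPairingAux {V W : Type*} [AddCommMonoid V] [Module ℝ V] [AddCommMonoid W] [Module ℝ W] (n : ℕ)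
    (B : V →ₗ[ℝ] W →ₗ[ℝ] ℝ) :
    MultilinearMap ℝ (fun _ : Fin n => V) (Sym[ℝ]^n W →ₗ[ℝ] ℝ) :=
  (LinearMap.compMultilinearMap
    { toFun := fun x => symLift
        (∑ σ : Equiv.Perm (Fin n),
          (((tensorPairing fun _ : Fin n => B) x).compMultilinearMap
            (PiTensorProduct.tprod ℝ)).domDomCongr σ)
        (fun τ w => by
          simp only [sum_apply, MultilinearMap.domDomCongr_apply]
          exact Fintype.sum_equiv (Equiv.mulLeft τ) _ _ (fun σ => rfl))
      map_add' := fun x y => sym_ext fun w => by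
        simp [Finset.sum_add_distrib]
      map_smul' := fun r x => sym_ext fun w => by
        simp [Finset.mul_sum] }
    (PiTensorProduct.tprod ℝ))

theorem symPairingAux_tprod {V W : Type*} [AddCommMonoid V] [Module ℝ V] [AddCommMonoid W]
    [Module ℝ W] (n : ℕ) (B : V →ₗ[ℝ] W →ₗ[ℝ] ℝ) (v : Fin n → V) (w : Fin n → W) :
    symPairingAux n B v (SymmetricPower.tprod ℝ w)
      = ∑ σ : Equiv.Perm (Fin n), ∏ i, B (v i) (w (σ i)) := by
  simp [symPairingAux, tensorPairing_tprod]

/-- The pairing of `Sym^n V` and `Sym^n W` induced by a pairing of `V` and `W`: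
`⟨v₁ ⋯ vₙ, w₁ ⋯ wₙ⟩ = ∑_σ ∏ᵢ ⟨vᵢ, w_{σ i}⟩`. -/
def symPairing {V W : Type*} [AddCommMonoid V] [Module ℝ V] [AddCommMonoid W] [Module ℝ W] (n : ℕ)
    (B : V →ₗ[ℝ] W →ₗ[ℝ] ℝ) : Sym[ℝ]^n V →ₗ[ℝ] Sym[ℝ]^n W →ₗ[ℝ] ℝ :=
  symLift (symPairingAux n B) (fun τ v => sym_ext fun w => by
    rw [symPairingAux_tprod, symPairingAux_tprod]
    refine Fintype.sum_equiv (Equiv.mulRight τ⁻¹) _ _ (fun σ => ?_)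
    refine Fintype.prod_equiv τ _ _ (fun i => ?_)
    simp)

theorem symPairing_tprod {V W : Type*} [AddCommMonoid V] [Module ℝ V] [AddCommMonoid W]
    [Module ℝ W] (n : ℕ) (B : V →ₗ[ℝ] W →ₗ[ℝ] ℝ) (v : Fin n → V) (w : Fin n → W) :
    symPairing n B (SymmetricPower.tprod ℝ v) (SymmetricPower.tprod ℝ w)
      = ∑ σ : Equiv.Perm (Fin n), ∏ i, B (v i) (w (σ i)) := by
  rw [symPairing, symLift_tprod, symPairingAux_tprod]

end SymmetricPowers

section Representations

/-- The tensor product action on `Sym^n V`: `g · (v₁ ⋯ vₙ) = (g v₁) ⋯ (g vₙ)`. -/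
def symRep {G V : Type*} [Group G] [AddCommMonoid V] [Module ℝ V] (ρ : Representation ℝ G V)
    (n : ℕ) : Representation ℝ G (Sym[ℝ]^n V) where
  toFun g := symMap n (ρ g)
  map_one' := sym_ext fun v => by simp
  map_mul' g h := sym_ext fun v => by simp

/-- The tensor product action on a tensor product of finitely many representations. -/
def piTensorRep {G ι : Type*} [Group G] {V : ι → Type*} [∀ i, AddCommMonoid (V i)]
    [∀ i, Module ℝ (V i)] (ρ : ∀ i, Representation ℝ G (V i)) :
    Representation ℝ G (⨂[ℝ] i, V i) where
  toFun g := PiTensorProduct.map fun i => ρ i g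
  map_one' := by
    simp only [map_one]
    exact PiTensorProduct.map_one
  map_mul' g h := by
    simp only [map_mul]
    exact PiTensorProduct.map_mul _ _

/-- The symmetric algebra of `V*` as the direct sum of the symmetric powers. -/
abbrev SymDual (V : Type) [AddCommMonoid V] [Module ℝ V] : Type :=
  ⨁ j : ℕ, Sym[ℝ]^j (Module.Dual ℝ V)

/-- The space `V ⊗ Sym V*`. Its elements are the Taylor polynomials, of arbitrary degree, of
vector fields on `V` at the origin. -/
abbrev Jets (V : Type) [AddCommMonoid V] [Module ℝ V] : Type :=
  V ⊗[ℝ] SymDual V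

/-- The inclusion of the degree `j` part `V ⊗ Sym^j V*` in `V ⊗ Sym V*`. -/
def jetsIncl (V : Type) [AddCommMonoid V] [Module ℝ V] (j : ℕ) :
    (V ⊗[ℝ] Sym[ℝ]^j (Module.Dual ℝ V)) →ₗ[ℝ] Jets V :=
  LinearMap.lTensor V (DirectSum.lof ℝ ℕ (fun j => Sym[ℝ]^j (Module.Dual ℝ V)) j)

/-- Truncation at order `k`: the projection of `V ⊗ Sym V*` onto `V ⊗ ⨁_{j ≤ k} Sym^j V*` along
the components of degree larger than `k`. -/
def jetsTrunc (V : Type) [AddCommMonoid V] [Module ℝ V] (k : ℕ) : Jets V →ₗ[ℝ] Jets V :=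
  LinearMap.lTensor V
    (DFinsupp.filterLinearMap ℝ (fun j => Sym[ℝ]^j (Module.Dual ℝ V)) (fun j => j ≤ k))

/-- The tensor product action on `V ⊗ Sym V*` (with the contragredient action on `V*`). -/
def jetsRep {G V : Type} [Group G] [AddCommMonoid V] [Module ℝ V] (ρ : Representation ℝ G V) :
    Representation ℝ G (Jets V) :=
  ρ.tprod (Representation.directSum fun j : ℕ => symRep ρ.dual j)

/-- The `G`-equivariant linear maps `Sym^m (V ⊗ Sym V*) → V`. -/
def equivariantLin {G V : Type} [Group G] [AddCommMonoid V] [Module ℝ V]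
    (ρ : Representation ℝ G V) (m : ℕ) : Submodule ℝ (Sym[ℝ]^m (Jets V) →ₗ[ℝ] V) where
  carrier := {L | ∀ g w, L (symRep (jetsRep ρ) m g w) = ρ g (L w)}
  zero_mem' := by simp
  add_mem' := by
    intro L L' h h' g w
    simp [h g w, h' g w]
  smul_mem' := by
    intro c L h g w
    simp [h g w]

/-- A linear map on `Sym^m (V ⊗ Sym V*)` has order at most `k` if it factors through the
truncation at order `k`, that is, through `Sym^m` of the space of `k`-jets. -/
def HasOrder {V N : Type} [AddCommMonoid V] [Module ℝ V] [AddCommMonoid N] [Module ℝ N] {m : ℕ}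
    (k : ℕ) (L : Sym[ℝ]^m (Jets V) →ₗ[ℝ] N) : Prop :=
  L ∘ₗ symMap m (jetsTrunc V k) = L

theorem jetsTrunc_comp {V : Type} [AddCommMonoid V] [Module ℝ V] (k l : ℕ) :
    jetsTrunc V k ∘ₗ jetsTrunc V l = jetsTrunc V (min k l) := by
  rw [jetsTrunc, jetsTrunc, ← LinearMap.lTensor_comp, jetsTrunc]
  congr 1
  refine LinearMap.ext fun x => DFinsupp.ext fun j => ?_
  change DFinsupp.filter _ (DFinsupp.filter _ x) j = DFinsupp.filter _ x j
  by_cases h1 : j ≤ k <;> by_cases h2 : j ≤ l <;> simp [DFinsupp.filter_apply, h1, h2]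

theorem HasOrder.mono {V N : Type} [AddCommMonoid V] [Module ℝ V] [AddCommMonoid N] [Module ℝ N]
    {m k l : ℕ} (hkl : k ≤ l) {L : Sym[ℝ]^m (Jets V) →ₗ[ℝ] N} (h : HasOrder k L) :
    HasOrder l L := by
  refine sym_ext fun w => ?_
  have key : ∀ w : Fin m → Jets V, L (SymmetricPower.tprod ℝ w)
      = L (SymmetricPower.tprod ℝ fun i => jetsTrunc V k (w i)) := fun w => by
    conv_lhs => rw [← h]
    simp
  rw [LinearMap.comp_apply, symMap_tprod, key, key w]
  congr 2
  funext i
  rw [← LinearMap.comp_apply, jetsTrunc_comp, min_eq_left hkl]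

/-- The `G`-equivariant linear maps `Sym^m (V ⊗ Sym V*) → V` of finite order. -/
def equivariantLinFin {G V : Type} [Group G] [AddCommMonoid V] [Module ℝ V]
    (ρ : Representation ℝ G V) (m : ℕ) : Submodule ℝ (Sym[ℝ]^m (Jets V) →ₗ[ℝ] V) where
  carrier := {L | L ∈ equivariantLin ρ m ∧ ∃ k, HasOrder k L}
  zero_mem' := ⟨Submodule.zero_mem _, 0, by simp [HasOrder]⟩
  add_mem' := by
    rintro L L' ⟨h, k, hk⟩ ⟨h', k', hk'⟩
    refine ⟨Submodule.add_mem _ h h', max k k', ?_⟩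
    have h1 : HasOrder (max k k') L := hk.mono (le_max_left _ _)
    have h2 : HasOrder (max k k') L' := hk'.mono (le_max_right _ _)
    unfold HasOrder at *
    rw [LinearMap.add_comp, h1, h2]
  smul_mem' := by
    rintro c L ⟨h, k, hk⟩
    refine ⟨Submodule.smul_mem _ c h, k, ?_⟩
    unfold HasOrder at *
    rw [LinearMap.smul_comp, hk]

/-- The space `Sym_κ = V ⊗ ⨂_j Sym^{κ(j)} (V* ⊗ Sym^j V)` of a composition `κ`, a finitely
supported function on `ℕ`; the factors with `κ(j) = 0` are omitted. -/
abbrev SymComp (V : Type) [AddCommMonoid V] [Module ℝ V] (κ : ℕ →₀ ℕ) : Type :=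
  V ⊗[ℝ] (⨂[ℝ] j : κ.support, Sym[ℝ]^(κ j) (Module.Dual ℝ V ⊗[ℝ] Sym[ℝ]^(j : ℕ) V))

/-- The tensor product action on `Sym_κ`. -/
def symCompRep {G V : Type} [Group G] [AddCommMonoid V] [Module ℝ V] (ρ : Representation ℝ G V)
    (κ : ℕ →₀ ℕ) : Representation ℝ G (SymComp V κ) :=
  ρ.tprod (piTensorRep fun j : κ.support => symRep (ρ.dual.tprod (symRep ρ (j : ℕ))) (κ j))

/-- The subspace `Sym_κ^G` of invariant elements. -/
abbrev symCompInvariants {G V : Type} [Group G] [AddCommGroup V] [Module ℝ V]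
    (ρ : Representation ℝ G V) (κ : ℕ →₀ ℕ) : Submodule ℝ (SymComp V κ) :=
  (symCompRep ρ κ).invariants

/-- The pairing of `V* ⊗ Sym^j V` and `V ⊗ Sym^j V*`:
`⟨ε ⊗ s, e ⊗ p⟩ = ε(e) ⟨s, p⟩`. -/
def degreePairing (V : Type) [AddCommMonoid V] [Module ℝ V] (j : ℕ) :
    (Module.Dual ℝ V ⊗[ℝ] Sym[ℝ]^j V) →ₗ[ℝ]
      (V ⊗[ℝ] Sym[ℝ]^j (Module.Dual ℝ V)) →ₗ[ℝ] ℝ :=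
  TensorProduct.dualDistrib ℝ V (Sym[ℝ]^j (Module.Dual ℝ V)) ∘ₗ
    LinearMap.lTensor (Module.Dual ℝ V) (symPairing j (Module.Dual.eval ℝ V))

/-- The canonical map `Sym_κ → Lin (⨂_j Sym^{κ(j)} (V ⊗ Sym^j V*), V)`,
`u ⊗ a ↦ (b ↦ ⟨a, b⟩ u)`. -/
def contraction (V : Type) [AddCommMonoid V] [Module ℝ V] (κ : ℕ →₀ ℕ) :
    SymComp V κ →ₗ[ℝ]
      (⨂[ℝ] j : κ.support, Sym[ℝ]^(κ j) (V ⊗[ℝ] Sym[ℝ]^(j : ℕ) (Module.Dual ℝ V))) →ₗ[ℝ] V :=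
  dualTensorHom ℝ _ V ∘ₗ (TensorProduct.comm ℝ V _).toLinearMap ∘ₗ
    LinearMap.lTensor V
      (tensorPairing fun j : κ.support => symPairing (κ j) (degreePairing V (j : ℕ)))

end Representations

section VectorFields

/-- The smooth vector fields on `ℝ^d`, as a subspace of all functions `ℝ^d → ℝ^d`. -/
def smoothFields (d : ℕ) : Submodule ℝ ((Fin d → ℝ) → (Fin d → ℝ)) where
  carrier := {f | ContDiff ℝ ∞ f}
  zero_mem' := (contDiff_const : ContDiff ℝ ∞ fun _ : Fin d → ℝ => (0 : Fin d → ℝ))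
  add_mem' := fun {f g} (hf : ContDiff ℝ ∞ f) (hg : ContDiff ℝ ∞ g) => hf.add hg
  smul_mem' := fun c f (hf : ContDiff ℝ ∞ f) => hf.const_smul c

/-- The space of smooth vector fields on `ℝ^d`. -/
def VField (d : ℕ) : Type := smoothFields d

instance (d : ℕ) : AddCommGroup (VField d) := inferInstanceAs (AddCommGroup (smoothFields d))

instance (d : ℕ) : Module ℝ (VField d) := inferInstanceAs (Module ℝ (smoothFields d))

instance (d : ℕ) : CoeFun (VField d) (fun _ => (Fin d → ℝ) → (Fin d → ℝ)) := ⟨Subtype.val⟩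

theorem VField.contDiff {d : ℕ} (f : VField d) : ContDiff ℝ ∞ f := f.2

/-- The `C^∞` (Fréchet) topology: uniform convergence of all derivatives on compact sets. -/
instance (d : ℕ) : TopologicalSpace (VField d) :=
  ⨅ n : ℕ, TopologicalSpace.induced
    (fun f => (⟨iteratedFDeriv ℝ n f,
        f.contDiff.continuous_iteratedFDeriv (by exact_mod_cast le_top)⟩ :
      C(Fin d → ℝ, (Fin d → ℝ)[×n]→L[ℝ] (Fin d → ℝ))))
    inferInstance

/-- The action of the affine transformation `x ↦ A x + b` on vector fields:
`((A, b) · f)(x) = A f(A⁻¹ (x - b))`. -/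
def affineAct {d : ℕ} (A : GL (Fin d) ℝ) (b : Fin d → ℝ) (f : VField d) : VField d :=
  ⟨fun x => A.val.mulVec (f ((A⁻¹).val.mulVec (x - b))), by
    have h : ∀ B : Matrix (Fin d) (Fin d) ℝ, ContDiff ℝ ∞ fun x => B.mulVec x := fun B =>
      (LinearMap.toContinuousLinearMap B.mulVecLin).contDiff
    exact (h _).comp (f.contDiff.comp ((h _).comp (contDiff_id.sub contDiff_const)))⟩

/-- Locality of an `m`-linear map: it is support non-increasing in each of its arguments. -/
def IsLocal {d m : ℕ} (φ : MultilinearMap ℝ (fun _ : Fin m => VField d) (VField d)) : Prop :=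
  ∀ (f : Fin m → VField d) (i : Fin m), tsupport (φ f) ⊆ tsupport (f i)

/-- Equivariance under `G = H ⋉ ℝ^d`, whose elements are the pairs `(A, b)` with `A ∈ H` and
`b ∈ ℝ^d`. -/
def IsEquivariant {d m : ℕ} (H : Subgroup (GL (Fin d) ℝ))
    (φ : MultilinearMap ℝ (fun _ : Fin m => VField d) (VField d)) : Prop :=
  ∀ A ∈ H, ∀ (b : Fin d → ℝ) (f : Fin m → VField d),
    φ (fun i => affineAct A b (f i)) = affineAct A b (φ f)

/-- Symmetry of an `m`-linear map. -/
def IsSymmetric {d m : ℕ} (φ : MultilinearMap ℝ (fun _ : Fin m => VField d) (VField d)) : Prop :=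
  ∀ (σ : Equiv.Perm (Fin m)) (f : Fin m → VField d), φ (fun i => f (σ i)) = φ f

/-- The space of local `G`-equivariant symmetric `m`-linear maps on vector fields of `ℝ^d`, where
`G = H ⋉ ℝ^d`. -/
def localEquivariantMaps (d : ℕ) (H : Subgroup (GL (Fin d) ℝ)) (m : ℕ) :
    Submodule ℝ (MultilinearMap ℝ (fun _ : Fin m => VField d) (VField d)) where
  carrier := {φ | IsSymmetric φ ∧ IsLocal φ ∧ IsEquivariant H φ}
  zero_mem' := by
    refine ⟨fun σ f => rfl, fun f i => ?_, fun A _ b f => ?_⟩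
    · have : ((0 : VField d) : (Fin d → ℝ) → (Fin d → ℝ)) = 0 := rfl
      simp [this]
    · refine Subtype.ext (funext fun x => ?_)
      exact (Matrix.mulVec_zero A.val).symm
  add_mem' := by
    rintro φ ψ ⟨h1, h2, h3⟩ ⟨h1', h2', h3'⟩
    refine ⟨fun σ f => ?_, fun f i => ?_, fun A hA b f => ?_⟩
    · simp [h1 σ f, h1' σ f]
    · exact (tsupport_add (φ f : (Fin d → ℝ) → (Fin d → ℝ)) (ψ f)).trans
        (Set.union_subset (h2 f i) (h2' f i))
    · rw [add_apply, h3 A hA, h3' A hA]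
      refine Subtype.ext (funext fun x => ?_)
      exact (Matrix.mulVec_add A.val _ _).symm
  smul_mem' := by
    rintro c φ ⟨h1, h2, h3⟩
    refine ⟨fun σ f => ?_, fun f i => ?_, fun A hA b f => ?_⟩
    · simp [h1 σ f]
    · refine Set.Subset.trans (closure_mono ?_) (h2 f i)
      exact Function.support_const_smul_subset c (φ f : (Fin d → ℝ) → (Fin d → ℝ))
    · rw [smul_apply, h3 A hA]
      refine Subtype.ext (funext fun x => ?_)
      exact (Matrix.mulVec_smul A.val c (φ f ((A⁻¹).val.mulVec (x - b)))).symm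

/-- The action of `H ⊆ GL(d)` on `ℝ^d` by matrix-vector multiplication. -/
def stdRep {d : ℕ} (H : Subgroup (GL (Fin d) ℝ)) : Representation ℝ H (Fin d → ℝ) where
  toFun A := A.val.val.mulVecLin
  map_one' := by simp; rfl
  map_mul' A B := by simp [Matrix.mulVecLin_mul]; rfl

/-- The Taylor expansion at the origin, up to order `k`, of a vector field, as an element of
`ℝ^d ⊗ Sym (ℝ^d)*`:
`∑_{j ≤ k} (1/j!) ∑_{α₁, …, α_j} ∂_{α₁} ⋯ ∂_{α_j} f(0) ⊗ dx_{α₁} ⋯ dx_{α_j}`. -/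
def taylorJet {d : ℕ} (k : ℕ) (f : VField d) : Jets (Fin d → ℝ) :=
  ∑ j ∈ Finset.range (k + 1), ∑ α : Fin j → Fin d,
    ((j.factorial : ℝ)⁻¹ • iteratedFDeriv ℝ j f 0 (fun t => Pi.single (α t) 1)) ⊗ₜ[ℝ]
      DirectSum.lof ℝ ℕ (fun j => Sym[ℝ]^j (Module.Dual ℝ (Fin d → ℝ))) j
        (SymmetricPower.tprod ℝ fun t => (LinearMap.proj (α t) : Module.Dual ℝ (Fin d → ℝ)))

end VectorFields

section Decomposition

/-- `HasComponent L κ s` says that the element `s` of `Sym_κ` represents the restriction of the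
linear map `L` to the subspace `⨂_j Sym^{κ(j)} (V ⊗ Sym^j V*)` of `Sym^m (V ⊗ Sym V*)` spanned by
the products with exactly `κ(j)` factors of degree `j`, for every `j`. -/
def HasComponent {V : Type} [AddCommMonoid V] [Module ℝ V] {m : ℕ}
    (L : Sym[ℝ]^m (Jets V) →ₗ[ℝ] V) (κ : ℕ →₀ ℕ) (s : SymComp V κ) : Prop :=
  ∀ (e : Fin m ≃ (Σ j : κ.support, Fin (κ j)))
    (x : ∀ j : κ.support, Fin (κ j) → V ⊗[ℝ] Sym[ℝ]^(j : ℕ) (Module.Dual ℝ V)),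
    contraction V κ s (PiTensorProduct.tprod ℝ fun j => SymmetricPower.tprod ℝ (x j))
      = L (SymmetricPower.tprod ℝ fun t => jetsIncl V (e t).1 (x (e t).1 (e t).2))

end Decomposition

end

end LocalEquivariant

open LocalEquivariant

/-! The analytic core is a multilinear Peetre theorem, `IsLocal.exists_order`, in which no
continuity is assumed. Suppose `φ f 0` could be non-zero with one argument flat of arbitrarily high
order. Cutting off and rescaling such counterexamples gives, for each `k`, fields with small support
whose derivatives up to order `k` are at most `2⁻ᵏ`, while `φ` of them has norm at least `k` at the
origin. Translated to disjoint balls around points `p k → 0` and summed, they form smooth fields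
`S`. Locality and translation equivariance give `‖φ S (p k)‖ ≥ k`, which contradicts the continuity
of the field `φ S` at `0`. Hence `φ f 0` depends only on jets of some finite order, and translations
carry this to every point.

The symbol of `φ` is read off from polynomial fields. Since `Sym M*` is an algebraic direct sum,
every element of `E ⊗ Sym M*` is the jet of a polynomial field (`taylorJet_polyField`), and a field
differs from its Taylor polynomial by a flat remainder (`isFlat_sub_polyField_taylorJet`).
Conversely, a symbol applied to the jets at every point is an operator (`jetOperator`). It is a
finite sum of products of partial derivatives, hence continuous in the Fréchet topology.

The algebra is a decomposition by degrees. In finite dimension the pairings are perfect, the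
factorials they produce being invertible in `ℝ`, so every restriction to a summand is represented by
exactly one element of `Sym_κ` (`exists_hasComponent`, `HasComponent.unique`). An element of `Sym^m`
meets only finitely many summands, so components can be prescribed arbitrarily
(`exists_of_components`); this gives the direct product. Only finitely many `κ` of size `m` involve
degrees at most `k`, so finite order means finitely many non-zero components; this gives the direct
sum. Conjugating a map by `g` applies `g` to its components (`HasComponent.conj`), so equivariance
means that all components are invariant. -/

namespace LocalEquivariant

open Topology

/-! ### Multilinear algebra preliminaries -/

/-- A relation between two modules that is compatible with the linear structure and under which
every element of either side has exactly one partner is the graph of a linear equivalence. -/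
theorem exists_linearEquiv_of_rel {M N : Type*} [AddCommMonoid M] [Module ℝ M] [AddCommMonoid N]
    [Module ℝ N] (R : M → N → Prop)
    (hadd : ∀ x x' y y', R x y → R x' y' → R (x + x') (y + y'))
    (hsmul : ∀ (c : ℝ) x y, R x y → R (c • x) (c • y))
    (hex : ∀ x, ∃ y, R x y) (huniq : ∀ x y y', R x y → R x y' → y = y')
    (hex' : ∀ y, ∃ x, R x y) (huniq' : ∀ x x' y, R x y → R x' y → x = x') :
    ∃ D : M ≃ₗ[ℝ] N, ∀ x, R x (D x) := by
  choose D hD using hex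
  let D' : M →ₗ[ℝ] N :=
    { toFun := D
      map_add' := fun x y => huniq _ _ _ (hD _) (hadd _ _ _ _ (hD x) (hD y))
      map_smul' := fun c x => huniq _ _ _ (hD _) (hsmul c _ _ (hD x)) }
  have hbij : Function.Bijective D' := by
    refine ⟨fun x x' h => huniq' x x' (D x) (hD x) ?_, fun y => ?_⟩
    · have h' : D x = D x' := h
      rw [h']; exact hD x'
    · obtain ⟨x, hx⟩ := hex' y
      exact ⟨x, huniq _ _ _ (hD x) hx⟩
  exact ⟨LinearEquiv.ofBijective D' hbij, hD⟩

/-- Induction on the set of slots whose argument is allowed to be arbitrary: freeing one more slot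
is linear extension from a spanning set. -/
theorem multilinear_ext_of_span {ι N : Type*} [Finite ι] {W : ι → Type*}
    [∀ i, AddCommMonoid (W i)] [∀ i, Module ℝ (W i)] [AddCommMonoid N] [Module ℝ N]
    {f g : MultilinearMap ℝ W N} (S : ∀ i, Set (W i)) (hS : ∀ i, Submodule.span ℝ (S i) = ⊤)
    (h : ∀ w : ∀ i, W i, (∀ i, w i ∈ S i) → f w = g w) : f = g := by
  classical
  have := Fintype.ofFinite ι
  have key : ∀ (s : Finset ι) (w : ∀ i, W i), (∀ i ∉ s, w i ∈ S i) → f w = g w := by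
    intro s
    induction s using Finset.induction_on with
    | empty => exact fun w hw => h w fun i => hw i (by simp)
    | insert a s ha ih =>
      intro w hw
      have hlin : f.toLinearMap w a = g.toLinearMap w a := by
        refine LinearMap.ext_on (hS a) fun y hy => ?_
        refine ih _ fun i hi => ?_
        by_cases hia : i = a
        · subst hia; simpa using hy
        · rw [Function.update_of_ne hia]; exact hw i (by simp [hia, hi])
      simpa using LinearMap.congr_fun hlin (w a)
  exact MultilinearMap.ext fun w => key Finset.univ w (by simp)

/-- This is used whenever all arguments of a multilinear map are expanded at once in dual families
or in coordinates. -/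
theorem multilinear_expand {ι N : Type*} [Fintype ι] [DecidableEq ι] {W : ι → Type*}
    [∀ i, AddCommMonoid (W i)]
    [∀ i, Module ℝ (W i)] [AddCommMonoid N] [Module ℝ N] {A : ι → Type*} [∀ i, Fintype (A i)]
    (f : MultilinearMap ℝ W N) (c : ∀ i, A i → W i) (r : ∀ i, A i → ℝ) (w : ∀ i, W i)
    (hw : ∀ i, ∑ a, r i a • c i a = w i) :
    ∑ α : ∀ i, A i, (∏ i, r i (α i)) • f (fun i => c i (α i)) = f w := by
  have : w = fun i => ∑ a, r i a • c i a := funext fun i => (hw i).symm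
  rw [this, MultilinearMap.map_sum]
  simp_rw [MultilinearMap.map_smul_univ]

theorem sym_induction {V : Type*} [AddCommMonoid V] [Module ℝ V] {n : ℕ}
    {p : Sym[ℝ]^n V → Prop} (htprod : ∀ v, p (SymmetricPower.tprod ℝ v))
    (hadd : ∀ x y, p x → p y → p (x + y)) (hsmul : ∀ (r : ℝ) x, p x → p (r • x)) (x : Sym[ℝ]^n V) :
    p x := by
  have hx : x ∈ Submodule.span ℝ (Set.range (SymmetricPower.tprod ℝ (ι := Fin n) (M := V))) := by
    rw [SymmetricPower.span_tprod_eq_top]; trivial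
  induction hx using Submodule.span_induction with
  | mem x h => obtain ⟨v, rfl⟩ := h; exact htprod v
  | zero => simpa using hsmul 0 _ (htprod 0)
  | add x y _ _ hx hy => exact hadd x y hx hy
  | smul r x _ hx => exact hsmul r x hx

/-! ### Dual families for the pairings -/

/-- Finite families `b` and `c` which are dual to each other with respect to a pairing. -/
structure DualFamilies {X Y A : Type*} [AddCommMonoid X] [Module ℝ X] [AddCommMonoid Y]
    [Module ℝ Y] [Fintype A] (B : X →ₗ[ℝ] Y →ₗ[ℝ] ℝ) (b : A → X) (c : A → Y) : Prop where
  left : ∀ x, ∑ a, B x (c a) • b a = x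
  right : ∀ y, ∑ a, B (b a) y • c a = y

/-- The pairing admits finite dual families, that is, it is a perfect pairing of finite-dimensional
spaces. -/
def HasDualFamilies {X Y : Type*} [AddCommMonoid X] [Module ℝ X] [AddCommMonoid Y] [Module ℝ Y]
    (B : X →ₗ[ℝ] Y →ₗ[ℝ] ℝ) : Prop :=
  ∃ (A : Type) (_ : Fintype A) (b : A → X) (c : A → Y), DualFamilies B b c

theorem HasDualFamilies.dualEval (V : Type) [AddCommGroup V] [Module ℝ V]
    [FiniteDimensional ℝ V] : HasDualFamilies (Module.Dual.eval ℝ V) := by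
  classical
  let v := Module.finBasis ℝ V
  refine ⟨_, inferInstance, v, v.coord, fun x => ?_, fun y => ?_⟩
  · simp [v.sum_repr x]
  · refine v.ext fun i => ?_
    simp

/-- The families run over all words `α : Fin n → A`, not over multisets, so they need not be bases.
Each of the `n!` permutations in the pairing reproduces the whole element, and the factor `1 / n!`
on one side compensates. -/
theorem HasDualFamilies.symPairing {X Y : Type*} [AddCommMonoid X] [Module ℝ X] [AddCommMonoid Y]
    [Module ℝ Y] {B : X →ₗ[ℝ] Y →ₗ[ℝ] ℝ} (h : HasDualFamilies B) (n : ℕ) :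
    HasDualFamilies (symPairing n B) := by
  classical
  obtain ⟨A, _, b, c, hbc⟩ := h
  have hn : (n.factorial : ℝ) ≠ 0 := by exact_mod_cast n.factorial_ne_zero
  refine ⟨Fin n → A, inferInstance,
    fun α => (n.factorial : ℝ)⁻¹ • SymmetricPower.tprod ℝ fun i => b (α i),
    fun α => SymmetricPower.tprod ℝ fun i => c (α i), fun x => ?_, fun y => ?_⟩
  · induction x using sym_induction with
    | htprod x =>
      simp_rw [symPairing_tprod, smul_smul, mul_comm _ (n.factorial : ℝ)⁻¹, mul_smul,
        ← Finset.smul_sum, Finset.sum_smul]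
      rw [Finset.sum_comm]
      have : ∀ σ : Equiv.Perm (Fin n), ∑ α : Fin n → A,
          (∏ i, B (x i) (c (α (σ i)))) • (SymmetricPower.tprod ℝ fun i => b (α i))
            = SymmetricPower.tprod ℝ x := fun σ => by
        -- Reordering the factors of `x` by `σ⁻¹` moves the permutation from the word `α` to `x`, so
        -- that the sum over words factorises.
        rw [← SymmetricPower.tprod_equiv σ⁻¹ x, ← multilinear_expand (A := fun _ => A)
          (SymmetricPower.tprod ℝ) (fun _ => b) (fun i a => B (x (σ⁻¹ i)) (c a))
          (fun i => x (σ⁻¹ i)) (fun i => hbc.left _)]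
        refine Finset.sum_congr rfl fun α _ => ?_
        congr 1
        exact Fintype.prod_equiv σ _ _ fun i => by simp
      simp [this, Fintype.card_perm, ← Nat.cast_smul_eq_nsmul ℝ, smul_smul, hn]
    | hadd x y hx hy =>
      simp_rw [map_add, LinearMap.add_apply, add_smul, Finset.sum_add_distrib, hx, hy]
    | hsmul r x hx =>
      simp_rw [map_smul, LinearMap.smul_apply, smul_assoc, ← Finset.smul_sum, hx]
  · induction y using sym_induction with
    | htprod y =>
      simp_rw [map_smul, LinearMap.smul_apply, smul_assoc, ← Finset.smul_sum, symPairing_tprod,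
        Finset.sum_smul]
      rw [Finset.sum_comm]
      have : ∀ σ : Equiv.Perm (Fin n), ∑ α : Fin n → A,
          (∏ i, B (b (α i)) (y (σ i))) • (SymmetricPower.tprod ℝ fun i => c (α i))
            = SymmetricPower.tprod ℝ y := fun σ => by
        rw [← SymmetricPower.tprod_equiv σ y, ← multilinear_expand (A := fun _ => A)
          (SymmetricPower.tprod ℝ) (fun _ => c) (fun i a => B (b a) (y (σ i)))
          (fun i => y (σ i)) (fun i => hbc.right _)]
      simp [this, Fintype.card_perm, ← Nat.cast_smul_eq_nsmul ℝ, smul_smul, hn]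
    | hadd x y hx hy =>
      simp_rw [map_add, add_smul, Finset.sum_add_distrib, hx, hy]
    | hsmul r x hx =>
      simp_rw [map_smul, smul_assoc, ← Finset.smul_sum] at hx ⊢
      rw [hx]

theorem degreePairing_tmul {V : Type} [AddCommMonoid V] [Module ℝ V] (j : ℕ)
    (ε : Module.Dual ℝ V) (s : Sym[ℝ]^j V) (e : V) (p : Sym[ℝ]^j (Module.Dual ℝ V)) :
    degreePairing V j (ε ⊗ₜ s) (e ⊗ₜ p)
      = ε e * LocalEquivariant.symPairing j (Module.Dual.eval ℝ V) s p := by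
  simp [degreePairing]

theorem HasDualFamilies.degreePairing (V : Type) [AddCommGroup V] [Module ℝ V]
    [FiniteDimensional ℝ V] (j : ℕ) : HasDualFamilies (degreePairing V j) := by
  classical
  obtain ⟨A, _, b, c, hbc⟩ := HasDualFamilies.dualEval V
  obtain ⟨A', _, b', c', hbc'⟩ := (HasDualFamilies.dualEval V).symPairing j
  refine ⟨A × A', inferInstance, fun a => c a.1 ⊗ₜ b' a.2, fun a => b a.1 ⊗ₜ c' a.2,
    fun x => ?_, fun y => ?_⟩
  · induction x using TensorProduct.induction_on with
    | zero => simp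
    | add x y hx hy => simp_rw [map_add, LinearMap.add_apply, add_smul, Finset.sum_add_distrib, hx, hy]
    | tmul x s =>
      have h1 := hbc.right x
      have h2 := hbc'.left s
      simp only [Module.Dual.eval_apply] at h1
      conv_rhs => rw [← h1, ← h2]
      simp_rw [TensorProduct.sum_tmul, TensorProduct.tmul_sum, Fintype.sum_prod_type,
        degreePairing_tmul, TensorProduct.smul_tmul_smul]
  · induction y using TensorProduct.induction_on with
    | zero => simp
    | add x y hx hy => simp_rw [map_add, add_smul, Finset.sum_add_distrib, hx, hy]
    | tmul x s =>
      have h1 := hbc.left x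
      have h2 := hbc'.right s
      simp only [Module.Dual.eval_apply] at h1
      conv_rhs => rw [← h1, ← h2]
      simp_rw [TensorProduct.sum_tmul, TensorProduct.tmul_sum, Fintype.sum_prod_type,
        degreePairing_tmul, TensorProduct.smul_tmul_smul]

/-- Only the expansion in the first variable is kept, which is what the injectivity of the
contraction requires. -/
theorem exists_left_dual_tensorPairing {ι : Type} [Fintype ι] {X Y : ι → Type*}
    [∀ i, AddCommMonoid (X i)] [∀ i, Module ℝ (X i)] [∀ i, AddCommMonoid (Y i)]
    [∀ i, Module ℝ (Y i)] {B : ∀ i, X i →ₗ[ℝ] Y i →ₗ[ℝ] ℝ} (h : ∀ i, HasDualFamilies (B i)) :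
    ∃ (A : Type) (_ : Fintype A) (b : A → ⨂[ℝ] i, X i) (c : A → ⨂[ℝ] i, Y i),
      ∀ x, ∑ a, tensorPairing B x (c a) • b a = x := by
  classical
  choose A hA b c hbc using h
  refine ⟨∀ i, A i, inferInstance, fun α => PiTensorProduct.tprod ℝ fun i => b i (α i),
    fun α => PiTensorProduct.tprod ℝ fun i => c i (α i), fun x => ?_⟩
  induction x using PiTensorProduct.induction_on with
  | add x y hx hy =>
    simp_rw [map_add, LinearMap.add_apply, add_smul, Finset.sum_add_distrib, hx, hy]
  | smul_tprod r x =>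
    simp_rw [map_smul, LinearMap.smul_apply, smul_assoc, ← Finset.smul_sum, tensorPairing_tprod]
    rw [multilinear_expand (PiTensorProduct.tprod ℝ) b (fun i a => B i (x i) (c i a)) x
      (fun i => (hbc i).left _)]

/-! ### Existence and uniqueness of components -/

theorem contraction_tmul {V : Type} [AddCommMonoid V] [Module ℝ V] (κ : ℕ →₀ ℕ) (u : V)
    (a : ⨂[ℝ] j : κ.support, Sym[ℝ]^(κ j) (Module.Dual ℝ V ⊗[ℝ] Sym[ℝ]^(j : ℕ) V))
    (b : ⨂[ℝ] j : κ.support, Sym[ℝ]^(κ j) (V ⊗[ℝ] Sym[ℝ]^(j : ℕ) (Module.Dual ℝ V))) :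
    contraction V κ (u ⊗ₜ a) b
      = tensorPairing (fun j : κ.support => symPairing (κ j) (degreePairing V (j : ℕ))) a b • u := by
  simp [contraction, dualTensorHom_apply]

/-- Dual families give a reconstruction formula: `s` is the sum of the values of its contraction at
the `c a`, tensored with the `b a`. -/
theorem contraction_injective (V : Type) [AddCommGroup V] [Module ℝ V] [FiniteDimensional ℝ V]
    (κ : ℕ →₀ ℕ) : Function.Injective (contraction V κ) := by
  obtain ⟨A, _, b, c, hbc⟩ := exists_left_dual_tensorPairing
    (fun j : κ.support => (HasDualFamilies.degreePairing V (j : ℕ)).symPairing (κ j))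
  have key : ∀ s, ∑ a, contraction V κ s (c a) ⊗ₜ b a = s := fun s => by
    induction s using TensorProduct.induction_on with
    | zero => simp
    | add x y hx hy =>
      simp_rw [map_add, LinearMap.add_apply, TensorProduct.add_tmul, Finset.sum_add_distrib, hx, hy]
    | tmul u a =>
      conv_rhs => rw [← hbc a]
      simp_rw [contraction_tmul, TensorProduct.tmul_sum, TensorProduct.smul_tmul]
  intro s s' h
  rw [← key s, ← key s', h]

theorem HasComponent.add {V : Type} [AddCommMonoid V] [Module ℝ V] {m : ℕ}
    {L L' : Sym[ℝ]^m (Jets V) →ₗ[ℝ] V} {κ : ℕ →₀ ℕ} {s s' : SymComp V κ}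
    (h : HasComponent L κ s) (h' : HasComponent L' κ s') :
    HasComponent (L + L') κ (s + s') := fun e x => by
  rw [map_add, LinearMap.add_apply, LinearMap.add_apply, h e x, h' e x]

theorem HasComponent.smul {V : Type} [AddCommMonoid V] [Module ℝ V] {m : ℕ} (r : ℝ)
    {L : Sym[ℝ]^m (Jets V) →ₗ[ℝ] V} {κ : ℕ →₀ ℕ} {s : SymComp V κ} (h : HasComponent L κ s) :
    HasComponent (r • L) κ (r • s) := fun e x => by
  rw [map_smul, LinearMap.smul_apply, LinearMap.smul_apply, h e x]

theorem nonempty_equiv_of_degree {m : ℕ} {κ : ℕ →₀ ℕ} (hκ : κ.degree = m) :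
    Nonempty (Fin m ≃ (Σ j : κ.support, Fin (κ j))) := by
  refine ⟨Fintype.equivOfCardEq ?_⟩
  rw [Fintype.card_sigma, Fintype.card_fin, ← hκ, Finsupp.degree_apply]
  simp only [Fintype.card_fin]
  exact (Finset.sum_coe_sort κ.support fun j => κ j).symm

theorem linearMap_ext_tprod_tprod {ι N : Type*} [Finite ι] {W : ι → Type*}
    [∀ i, AddCommMonoid (W i)] [∀ i, Module ℝ (W i)] [AddCommMonoid N] [Module ℝ N] {n : ι → ℕ}
    {f g : (⨂[ℝ] i, Sym[ℝ]^(n i) (W i)) →ₗ[ℝ] N}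
    (h : ∀ x : ∀ i, Fin (n i) → W i,
      f (PiTensorProduct.tprod ℝ fun i => SymmetricPower.tprod ℝ (x i))
        = g (PiTensorProduct.tprod ℝ fun i => SymmetricPower.tprod ℝ (x i))) : f = g := by
  refine PiTensorProduct.ext (multilinear_ext_of_span (fun i => Set.range (SymmetricPower.tprod ℝ))
    (fun i => SymmetricPower.span_tprod_eq_top _ _ _) fun w hw => ?_)
  choose x hx using hw
  obtain rfl : (fun i => SymmetricPower.tprod ℝ (x i)) = w := funext hx
  exact h x

/-- The condition on the size of `κ` supplies an enumeration of the slots; without one,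
`HasComponent` is vacuous. -/
theorem HasComponent.unique {V : Type} [AddCommGroup V] [Module ℝ V] [FiniteDimensional ℝ V]
    {m : ℕ} {L : Sym[ℝ]^m (Jets V) →ₗ[ℝ] V} {κ : ℕ →₀ ℕ} (hκ : κ.degree = m) {s s' : SymComp V κ}
    (h : HasComponent L κ s) (h' : HasComponent L κ s') : s = s' := by
  obtain ⟨e⟩ := nonempty_equiv_of_degree hκ
  exact contraction_injective V κ (linearMap_ext_tprod_tprod fun x => by rw [h e x, h' e x])

theorem tprod_comp_equiv {V : Type*} [AddCommMonoid V] [Module ℝ V] {n : ℕ} {ι : Type*}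
    (e e' : Fin n ≃ ι) (z : ι → V) :
    SymmetricPower.tprod ℝ (fun t => z (e t)) = SymmetricPower.tprod ℝ fun t => z (e' t) := by
  rw [← SymmetricPower.tprod_equiv (e.trans e'.symm) fun t => z (e' t)]
  simp

/-- The representing element is the sum, over all choices of one dual basis index per slot, of the
value of `L` on the product of the `c`'s tensored with the product of the `b`'s. Pairing it with a
product sums over the permutations `S` inside each degree, and each permutation returns the same
value of `L`; hence the division by the order of `S`. -/
theorem exists_hasComponent {V : Type} [AddCommGroup V] [Module ℝ V] [FiniteDimensional ℝ V]
    {m : ℕ} (L : Sym[ℝ]^m (Jets V) →ₗ[ℝ] V) {κ : ℕ →₀ ℕ} (hκ : κ.degree = m) :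
    ∃ s, HasComponent L κ s := by
  classical
  obtain ⟨e⟩ := nonempty_equiv_of_degree hκ
  choose A hA b c hbc using fun j : κ.support => HasDualFamilies.degreePairing V (j : ℕ)
  let M : MultilinearMap ℝ (fun p : (Σ j : κ.support, Fin (κ j)) =>
      V ⊗[ℝ] Sym[ℝ]^(p.1 : ℕ) (Module.Dual ℝ V)) V :=
    ((L.compMultilinearMap (SymmetricPower.tprod ℝ)).domDomCongr e).compLinearMap
      fun p => jetsIncl V p.1
  have hM : ∀ x, M x = L (SymmetricPower.tprod ℝ fun t => jetsIncl V (e t).1 (x (e t))) :=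
    fun x => rfl
  let S := ∀ j : κ.support, Equiv.Perm (Fin (κ j))
  have hS : (Fintype.card S : ℝ) ≠ 0 := by exact_mod_cast Fintype.card_ne_zero
  refine ⟨(Fintype.card S : ℝ)⁻¹ • ∑ α : (∀ p : (Σ j : κ.support, Fin (κ j)), A p.1),
    M (fun p => c p.1 (α p)) ⊗ₜ
      PiTensorProduct.tprod ℝ fun j => SymmetricPower.tprod ℝ fun r => b j (α ⟨j, r⟩),
    fun e' x => ?_⟩
  -- Permuting factors of equal degree does not change their product in `Sym^m`.
  have hx : ∀ σ : S, M (fun p => x p.1 (σ p.1 p.2)) = M fun p => x p.1 p.2 := fun σ => by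
    rw [hM, hM]
    congr 1
    exact tprod_comp_equiv (e.trans (Equiv.sigmaCongrRight σ)) e
      fun p : (Σ j : κ.support, Fin (κ j)) => jetsIncl V p.1 (x p.1 p.2)
  have hfinal : L (SymmetricPower.tprod ℝ fun t => jetsIncl V (e' t).1 (x (e' t).1 (e' t).2))
      = M fun p => x p.1 p.2 := by
    rw [hM]
    congr 1
    exact tprod_comp_equiv e' e
      fun p : (Σ j : κ.support, Fin (κ j)) => jetsIncl V p.1 (x p.1 p.2)
  rw [hfinal]
  simp_rw [map_smul, map_sum, LinearMap.smul_apply, LinearMap.sum_apply, contraction_tmul,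
    tensorPairing_tprod, symPairing_tprod, Finset.prod_univ_sum, Finset.sum_smul,
    Fintype.piFinset_univ]
  rw [Finset.sum_comm]
  have : ∀ σ : S, ∑ α : (∀ p : (Σ j : κ.support, Fin (κ j)), A p.1),
      (∏ j : κ.support, ∏ r, degreePairing V (j : ℕ) (b j (α ⟨j, r⟩)) (x j (σ j r))) •
        M (fun p => c p.1 (α p)) = M fun p => x p.1 p.2 := fun σ => by
    rw [← hx σ, ← multilinear_expand M (fun p a => c p.1 a)
      (fun p a => degreePairing V (p.1 : ℕ) (b p.1 a) (x p.1 (σ p.1 p.2)))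
      (fun p => x p.1 (σ p.1 p.2)) (fun p => (hbc p.1).right _)]
    refine Finset.sum_congr rfl fun α _ => ?_
    rw [Fintype.prod_sigma]
  simp_rw [this]
  rw [Finset.sum_const, ← Nat.cast_smul_eq_nsmul ℝ, smul_smul, Finset.card_univ,
    inv_mul_cancel₀ hS, one_smul]

/-! ### Reduction to homogeneous factors -/

/-- The elements of `V ⊗ Sym V*` of a single degree. -/
def homogeneousJets (V : Type) [AddCommMonoid V] [Module ℝ V] : Set (Jets V) :=
  {w | ∃ j y, jetsIncl V j y = w}

theorem span_homogeneousJets (V : Type) [AddCommMonoid V] [Module ℝ V] :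
    Submodule.span ℝ (homogeneousJets V) = ⊤ := by
  refine eq_top_iff.2 fun w _ => ?_
  induction w using TensorProduct.induction_on with
  | zero => exact Submodule.zero_mem _
  | add x y hx hy => exact Submodule.add_mem _ (hx trivial) (hy trivial)
  | tmul u p =>
    induction p using DirectSum.induction_on with
    | zero => rw [TensorProduct.tmul_zero]; exact Submodule.zero_mem _
    | add x y hx hy => rw [TensorProduct.tmul_add]; exact Submodule.add_mem _ (hx trivial) (hy trivial)
    | of j s => exact Submodule.subset_span ⟨j, u ⊗ₜ s, rfl⟩

theorem linearMap_ext_homogeneous {V N : Type} [AddCommMonoid V] [Module ℝ V] [AddCommMonoid N]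
    [Module ℝ N] {m : ℕ} {L L' : Sym[ℝ]^m (Jets V) →ₗ[ℝ] N}
    (h : ∀ w : Fin m → Jets V, (∀ t, w t ∈ homogeneousJets V) →
      L (SymmetricPower.tprod ℝ w) = L' (SymmetricPower.tprod ℝ w)) : L = L' :=
  sym_ext fun v => DFunLike.congr_fun (multilinear_ext_of_span
    (f := L.compMultilinearMap (SymmetricPower.tprod ℝ))
    (g := L'.compMultilinearMap (SymmetricPower.tprod ℝ))
    (fun _ => homogeneousJets V) (fun _ => span_homogeneousJets V) h) v

/-- A product of homogeneous elements lies in the summand indexed by the composition which counts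
the degrees of the factors. -/
theorem exists_composition {m : ℕ} (j : Fin m → ℕ) :
    ∃ κ : ℕ →₀ ℕ, κ.degree = m ∧ (∀ i ∈ κ.support, ∃ t, j t = i) ∧
      ∃ e : Fin m ≃ (Σ i : κ.support, Fin (κ i)), ∀ t, ((e t).1 : ℕ) = j t := by
  classical
  let κ : ℕ →₀ ℕ := ∑ t, Finsupp.single (j t) 1
  have hκ : ∀ i, κ i = Fintype.card {t // j t = i} := fun i => by
    simp [κ, Finsupp.finsetSum_apply, Finsupp.single_apply, Fintype.card_subtype]
  have hmem : ∀ t, j t ∈ κ.support := fun t => by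
    rw [Finsupp.mem_support_iff, hκ]
    exact (Fintype.card_pos_iff.2 ⟨⟨t, rfl⟩⟩).ne'
  refine ⟨κ, by simp [κ], fun i hi => ?_, ?_⟩
  · rw [Finsupp.mem_support_iff, hκ] at hi
    obtain ⟨t, ht⟩ := Fintype.card_pos_iff.1 (Nat.pos_of_ne_zero hi)
    exact ⟨t, ht⟩
  · let q : Fin m → κ.support := fun t => ⟨j t, hmem t⟩
    have hq : ∀ i : κ.support, Nonempty ({t // q t = i} ≃ Fin (κ i)) := fun i =>
      ⟨Fintype.equivOfCardEq (by
        rw [Fintype.card_fin, hκ]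
        exact Fintype.card_congr (Equiv.subtypeEquivRight fun t => Subtype.ext_iff))⟩
    refine ⟨(Equiv.sigmaFiberEquiv q).symm.trans
      (Equiv.sigmaCongrRight fun i => (hq i).some), fun t => rfl⟩

/-- Products of homogeneous jets span `Sym^m`, and each of them lies in the summand of the
composition that counts its degrees. -/
theorem eq_of_hasComponent {V : Type} [AddCommMonoid V] [Module ℝ V] {m : ℕ}
    {L L' : Sym[ℝ]^m (Jets V) →ₗ[ℝ] V} (s : ∀ κ : {κ : ℕ →₀ ℕ // κ.degree = m}, SymComp V κ.1)
    (h : ∀ κ, HasComponent L κ.1 (s κ)) (h' : ∀ κ, HasComponent L' κ.1 (s κ)) : L = L' := by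
  refine linearMap_ext_homogeneous fun w hw => ?_
  choose j y hy using hw
  obtain ⟨κ, hκ, -, e, he⟩ := exists_composition j
  have hx : ∀ p : (Σ i : κ.support, Fin (κ i)),
      ∃ x, jetsIncl V (p.1 : ℕ) x = w (e.symm p) := fun p => by
    have := he (e.symm p)
    rw [Equiv.apply_symm_apply] at this
    rw [this]
    exact ⟨_, hy _⟩
  choose x hx using hx
  have hw : w = fun t => jetsIncl V (e t).1 (x (e t)) := funext fun t => by simp [hx]
  have h1 := h ⟨κ, hκ⟩ e fun i r => x ⟨i, r⟩
  have h2 := h' ⟨κ, hκ⟩ e fun i r => x ⟨i, r⟩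
  rw [hw]
  exact h1.symm.trans h2

/-! ### Truncation and order -/

theorem jetsTrunc_jetsIncl_of_le {V : Type} [AddCommMonoid V] [Module ℝ V] {j k : ℕ} (h : j ≤ k)
    (y : V ⊗[ℝ] Sym[ℝ]^j (Module.Dual ℝ V)) :
    jetsTrunc V k (jetsIncl V j y) = jetsIncl V j y := by
  rw [jetsTrunc, jetsIncl, ← LinearMap.comp_apply, ← LinearMap.lTensor_comp]
  congr 2
  exact LinearMap.ext fun s => DFinsupp.filter_single_pos
    (β := fun j => Sym[ℝ]^j (Module.Dual ℝ V)) (p := fun i => i ≤ k) j s h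

theorem jetsTrunc_jetsIncl_of_lt {V : Type} [AddCommMonoid V] [Module ℝ V] {j k : ℕ} (h : k < j)
    (y : V ⊗[ℝ] Sym[ℝ]^j (Module.Dual ℝ V)) : jetsTrunc V k (jetsIncl V j y) = 0 := by
  rw [jetsTrunc, jetsIncl, ← LinearMap.comp_apply, ← LinearMap.lTensor_comp]
  have : DFinsupp.filterLinearMap ℝ (fun j => Sym[ℝ]^j (Module.Dual ℝ V)) (fun i => i ≤ k) ∘ₗ
      DirectSum.lof ℝ ℕ (fun j => Sym[ℝ]^j (Module.Dual ℝ V)) j = 0 := by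
    exact LinearMap.ext fun s => DFinsupp.filter_single_neg
      (β := fun j => Sym[ℝ]^j (Module.Dual ℝ V)) (p := fun i => i ≤ k) j s h.not_ge
  rw [this]
  simp

theorem exists_jetsTrunc_eq {V : Type} [AddCommMonoid V] [Module ℝ V] (w : Jets V) :
    ∃ k₀, ∀ k ≥ k₀, jetsTrunc V k w = w := by
  have hw : w ∈ Submodule.span ℝ (homogeneousJets V) := by rw [span_homogeneousJets]; trivial
  induction hw using Submodule.span_induction with
  | mem x h =>
    obtain ⟨j, y, rfl⟩ := h
    exact ⟨j, fun k hk => jetsTrunc_jetsIncl_of_le hk y⟩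
  | zero => exact ⟨0, fun k _ => map_zero _⟩
  | add x y _ _ hx hy =>
    obtain ⟨k, hk⟩ := hx
    obtain ⟨l, hl⟩ := hy
    exact ⟨max k l, fun i hi => by
      rw [map_add, hk i (le_trans (le_max_left _ _) hi), hl i (le_trans (le_max_right _ _) hi)]⟩
  | smul r x _ hx =>
    obtain ⟨k, hk⟩ := hx
    exact ⟨k, fun i hi => by rw [map_smul, hk i hi]⟩

theorem HasOrder.apply_tprod {V N : Type} [AddCommMonoid V] [Module ℝ V] [AddCommMonoid N]
    [Module ℝ N] {m k : ℕ} {L : Sym[ℝ]^m (Jets V) →ₗ[ℝ] N} (h : HasOrder k L)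
    (w : Fin m → Jets V) :
    L (SymmetricPower.tprod ℝ fun i => jetsTrunc V k (w i)) = L (SymmetricPower.tprod ℝ w) := by
  conv_rhs => rw [← h]
  simp

/-! ### Construction of a linear map with given components -/

theorem exists_jetsProj (V : Type) [AddCommMonoid V] [Module ℝ V] (i : ℕ) :
    ∃ π : Jets V →ₗ[ℝ] V ⊗[ℝ] Sym[ℝ]^i (Module.Dual ℝ V),
      (∀ y, π (jetsIncl V i y) = y) ∧ ∀ j ≠ i, ∀ y, π (jetsIncl V j y) = 0 := by
  refine ⟨LinearMap.lTensor V (DirectSum.component ℝ ℕ _ i), fun y => ?_, fun j hj y => ?_⟩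
  · rw [jetsIncl, ← LinearMap.comp_apply, ← LinearMap.lTensor_comp]
    rw [DirectSum.component_comp_lof_same]
    simp
  · rw [jetsIncl, ← LinearMap.comp_apply, ← LinearMap.lTensor_comp]
    have : DirectSum.component ℝ ℕ (fun j => Sym[ℝ]^j (Module.Dual ℝ V)) i ∘ₗ
        DirectSum.lof ℝ ℕ (fun j => Sym[ℝ]^j (Module.Dual ℝ V)) j = 0 := by
      refine LinearMap.ext fun s => ?_
      simp [DirectSum.component.of, hj]
    rw [this]
    simp

/-- A composition is recovered from its slots by counting those of each degree, and a
degree-preserving bijection keeps the counts. -/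
theorem eq_of_fiber_preserving_equiv {κ κ' : ℕ →₀ ℕ}
    (τ : (Σ j : κ.support, Fin (κ j)) ≃ (Σ j : κ'.support, Fin (κ' j)))
    (hτ : ∀ p, ((τ p).1 : ℕ) = p.1) : κ = κ' := by
  have key : ∀ (κ : ℕ →₀ ℕ) (i : ℕ),
      ∑ p : (Σ j : κ.support, Fin (κ j)), (if (p.1 : ℕ) = i then 1 else 0) = κ i := fun κ i => by
    rw [Fintype.sum_sigma]
    have : ∀ j : κ.support, ∑ _ : Fin (κ j), (if (j : ℕ) = i then 1 else 0)
        = κ j * if (j : ℕ) = i then 1 else 0 := fun j => by simp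
    refine (Finset.sum_congr rfl fun j _ => this j).trans ?_
    rw [Finset.sum_coe_sort κ.support fun j => κ j * if j = i then 1 else 0]
    simp +contextual
  refine Finsupp.ext fun i => ?_
  rw [← key κ i, ← key κ' i]
  exact Fintype.sum_equiv τ _ _ fun p => by rw [hτ]

theorem exists_perm_of_fiber_preserving {ι : Type*} {n : ι → ℕ}
    (τ : Equiv.Perm (Σ j, Fin (n j))) (hτ : ∀ p, (τ p).1 = p.1) :
    ∃ σ : ∀ j, Equiv.Perm (Fin (n j)), ∀ j r, τ ⟨j, r⟩ = ⟨j, σ j r⟩ := by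
  have h2 : ∀ j r, ∃ r', τ ⟨j, r⟩ = ⟨j, r'⟩ := fun j r => by
    have := hτ ⟨j, r⟩
    generalize τ ⟨j, r⟩ = q at this
    obtain ⟨j', r'⟩ := q
    obtain rfl : j' = j := this
    exact ⟨r', rfl⟩
  choose σ hσ using h2
  have hinj : ∀ j, Function.Injective (σ j) := fun j r r' h => by
    have := (hσ j r).trans ((congrArg _ h).trans (hσ j r').symm)
    simpa using τ.injective this
  exact ⟨fun j => Equiv.ofBijective (σ j) (Finite.injective_iff_bijective.1 (hinj j)), hσ⟩

/-- Any element of `Sym_κ` is the `κ`-component of a linear map all of whose other components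
vanish. -/
theorem exists_single_component {V : Type} [AddCommGroup V] [Module ℝ V] {m : ℕ} (κ : ℕ →₀ ℕ)
    (s : SymComp V κ) :
    ∃ L : Sym[ℝ]^m (Jets V) →ₗ[ℝ] V, HasComponent L κ s ∧
      ∀ κ' : ℕ →₀ ℕ, κ' ≠ κ → HasComponent L κ' 0 := by
  classical
  choose π hπ hπ' using exists_jetsProj V
  let T : MultilinearMap ℝ (fun _ : (Σ j : κ.support, Fin (κ j)) => Jets V) V :=
    (contraction V κ s).compMultilinearMap ((PiTensorProduct.tprod ℝ).compMultilinearMap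
      fun j : κ.support => (SymmetricPower.tprod ℝ (ι := Fin (κ j))).compLinearMap fun _ => π j)
  have hT : ∀ z, T z = contraction V κ s (PiTensorProduct.tprod ℝ fun j : κ.support =>
      SymmetricPower.tprod ℝ fun r : Fin (κ j) => π j (z ⟨j, r⟩)) := fun z => rfl
  have hT0 : ∀ z p, π p.1 (z p) = 0 → T z = 0 := fun z p hp => by
    rw [hT, MultilinearMap.map_coord_zero _ p.1, map_zero]
    exact MultilinearMap.map_coord_zero _ p.2 hp
  -- Summing over all assignments of factors to slots makes the map symmetric. The projections `π`
  -- kill every assignment that puts a factor into a slot of another degree.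
  let F : MultilinearMap ℝ (fun _ : Fin m => Jets V) V :=
    ∑ e : Fin m ≃ (Σ j : κ.support, Fin (κ j)), T.domDomCongr e.symm
  have hF' : ∀ w, F w = ∑ e : Fin m ≃ (Σ j : κ.support, Fin (κ j)), T fun p => w (e.symm p) :=
    fun w => by simp [F, sum_apply]
  have hF : ∀ (σ : Equiv.Perm (Fin m)) (w : Fin m → Jets V), F (fun t => w (σ t)) = F w :=
    fun σ w => by
      rw [hF', hF']
      exact Fintype.sum_equiv (Equiv.equivCongr σ (Equiv.refl _)) _ _ fun e => rfl
  -- On a product of type `κ`, the surviving assignments correspond to the degree-preserving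
  -- permutations of the slots. All of them contribute the same value, so their number is divided
  -- out.
  let P := {τ : Equiv.Perm (Σ j : κ.support, Fin (κ j)) // ∀ p, (τ p).1 = p.1}
  have hP : (Fintype.card P : ℝ) ≠ 0 := by
    have : Nonempty P := ⟨⟨1, fun p => rfl⟩⟩
    exact_mod_cast Fintype.card_ne_zero
  refine ⟨(Fintype.card P : ℝ)⁻¹ • symLift F hF, fun e x => ?_, fun κ' hne e x => ?_⟩
  · let z : (Σ j : κ.support, Fin (κ j)) → Jets V := fun p => jetsIncl V p.1 (x p.1 p.2)
    obtain ⟨c, hc⟩ : ∃ c, c = contraction V κ s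
        (PiTensorProduct.tprod ℝ fun j => SymmetricPower.tprod ℝ (x j)) := ⟨_, rfl⟩
    have h1 : ∀ τ : Equiv.Perm (Σ j : κ.support, Fin (κ j)), (∀ p, (τ p).1 = p.1) →
        T (fun p => z (τ p)) = c := fun τ hτ => by
      obtain ⟨σ, hσ⟩ := exists_perm_of_fiber_preserving τ hτ
      have hz : ∀ j : κ.support, (SymmetricPower.tprod ℝ fun r => π j (z (τ ⟨j, r⟩)))
          = SymmetricPower.tprod ℝ (x j) := fun j => by
        rw [← SymmetricPower.tprod_equiv (σ j) (x j)]
        refine congrArg _ (funext fun r => ?_)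
        rw [hσ]
        exact hπ _ _
      rw [hT]
      simp_rw [hz, hc]
    have h2 : ∀ τ : Equiv.Perm (Σ j : κ.support, Fin (κ j)), (¬ ∀ p, (τ p).1 = p.1) →
        T (fun p => z (τ p)) = 0 := fun τ hτ => by
      push Not at hτ
      obtain ⟨p, hp⟩ := hτ
      exact hT0 _ p (hπ' _ _ (fun h => hp (Subtype.ext h)) _)
    have h3 : F (fun t => z (e t)) = ∑ τ : Equiv.Perm (Σ j : κ.support, Fin (κ j)),
        if ∀ p, (τ p).1 = p.1 then c else 0 := by
      rw [hF']
      refine Fintype.sum_equiv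
        (⟨fun e' => e'.symm.trans e, fun τ => e.trans τ.symm, fun e' => Equiv.ext fun t => by simp,
          fun τ => Equiv.ext fun p => by simp⟩ : (Fin m ≃ _) ≃ Equiv.Perm _) _ _ fun e' => ?_
      change T (fun p => z ((e'.symm.trans e) p))
        = if ∀ p, ((e'.symm.trans e) p).1 = p.1 then c else 0
      generalize e'.symm.trans e = τ
      split_ifs with h
      · exact h1 τ h
      · exact h2 τ h
    rw [LinearMap.smul_apply, symLift_tprod]
    refine Eq.trans ?_ (congrArg _ h3.symm)
    rw [← hc, ← Finset.sum_filter, Finset.sum_const, ← Fintype.card_subtype, ← Nat.cast_smul_eq_nsmul ℝ,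
      smul_smul, inv_mul_cancel₀ hP, one_smul]
  · rw [map_zero, LinearMap.zero_apply, LinearMap.smul_apply, symLift_tprod, hF',
      Finset.sum_eq_zero, smul_zero]
    intro e' _
    -- On a product of another type, no assignment matches all degrees, since this would identify
    -- the two compositions.
    have : ∃ p, ((e (e'.symm p)).1 : ℕ) ≠ p.1 := by
      by_contra! h
      exact hne (eq_of_fiber_preserving_equiv (e'.symm.trans e) h).symm
    obtain ⟨p, hp⟩ := this
    exact hT0 _ p (hπ' _ _ hp _)

theorem HasComponent.comp_jetsTrunc {V : Type} [AddCommMonoid V] [Module ℝ V] {m k : ℕ}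
    {L : Sym[ℝ]^m (Jets V) →ₗ[ℝ] V} {κ : ℕ →₀ ℕ} {s : SymComp V κ} (h : HasComponent L κ s)
    (hκ : ∀ i ∈ κ.support, i ≤ k) : HasComponent (L ∘ₗ symMap m (jetsTrunc V k)) κ s := by
  intro e x
  rw [LinearMap.comp_apply, symMap_tprod]
  simp_rw [fun t => jetsTrunc_jetsIncl_of_le (hκ _ (e t).1.2) (x (e t).1 (e t).2)]
  exact h e x

theorem hasComponent_comp_jetsTrunc_zero {V : Type} [AddCommMonoid V] [Module ℝ V] {m k : ℕ}
    (L : Sym[ℝ]^m (Jets V) →ₗ[ℝ] V) {κ : ℕ →₀ ℕ} (hκ : ¬ ∀ i ∈ κ.support, i ≤ k) :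
    HasComponent (L ∘ₗ symMap m (jetsTrunc V k)) κ 0 := by
  intro e x
  push Not at hκ
  obtain ⟨i, hi, hki⟩ := hκ
  have hi' : 0 < κ i := Nat.pos_of_ne_zero (Finsupp.mem_support_iff.1 hi)
  rw [map_zero, LinearMap.zero_apply, LinearMap.comp_apply, symMap_tprod,
    MultilinearMap.map_coord_zero _ (e.symm ⟨⟨i, hi⟩, ⟨0, hi'⟩⟩), map_zero]
  rw [jetsTrunc_jetsIncl_of_lt]
  simpa using hki

/-- A map of order `k` has no components which involve a degree larger than `k`. -/
theorem HasComponent.eq_zero_of_hasOrder {V : Type} [AddCommGroup V] [Module ℝ V]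
    [FiniteDimensional ℝ V] {m k : ℕ} {L : Sym[ℝ]^m (Jets V) →ₗ[ℝ] V} (hL : HasOrder k L)
    {κ : ℕ →₀ ℕ} (hκ : κ.degree = m) {s : SymComp V κ} (h : HasComponent L κ s)
    (hk : ¬ ∀ i ∈ κ.support, i ≤ k) : s = 0 := by
  have := hasComponent_comp_jetsTrunc_zero L hk
  rw [hL] at this
  exact h.unique hκ this

/-- If the only non-zero components involve degrees at most `k`, then the order is at most `k`. -/
theorem hasOrder_of_hasComponent {V : Type} [AddCommMonoid V] [Module ℝ V]
    {m k : ℕ} {L : Sym[ℝ]^m (Jets V) →ₗ[ℝ] V}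
    {s : ∀ κ : {κ : ℕ →₀ ℕ // κ.degree = m}, SymComp V κ.1} (h : ∀ κ, HasComponent L κ.1 (s κ))
    (hs : ∀ κ, s κ ≠ 0 → ∀ i ∈ κ.1.support, i ≤ k) : HasOrder k L := by
  refine eq_of_hasComponent s (fun κ => ?_) h
  by_cases hκ : ∀ i ∈ κ.1.support, i ≤ k
  · exact (h κ).comp_jetsTrunc hκ
  · rw [by_contra fun h0 => hκ (hs κ h0)]
    exact hasComponent_comp_jetsTrunc_zero L hκ

/-- This links finite order with finite support of the family of components. -/
theorem finite_compositions (m k : ℕ) :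
    {κ : {κ : ℕ →₀ ℕ // κ.degree = m} | ∀ i ∈ κ.1.support, i ≤ k}.Finite := by
  refine Set.Finite.of_finite_image (f := Subtype.val)
    (Set.Finite.subset (Finset.finite_toSet (Finset.finsuppAntidiag (Finset.range (k + 1)) m)) ?_)
    Subtype.val_injective.injOn
  rintro _ ⟨κ, hκ, rfl⟩
  rw [Finset.mem_coe, Finset.mem_finsuppAntidiag']
  refine ⟨κ.2, fun i hi => ?_⟩
  simpa [Nat.lt_succ_iff] using hκ i hi

theorem exists_symMap_jetsTrunc_eq {V : Type} [AddCommMonoid V] [Module ℝ V] {m : ℕ}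
    (x : Sym[ℝ]^m (Jets V)) : ∃ k₀, ∀ k ≥ k₀, symMap m (jetsTrunc V k) x = x := by
  induction x using sym_induction with
  | htprod w =>
    choose k hk using fun i => exists_jetsTrunc_eq (w i)
    refine ⟨Finset.univ.sup k, fun l hl => ?_⟩
    rw [symMap_tprod]
    congr 1
    exact funext fun i => hk i l ((Finset.le_sup (Finset.mem_univ i)).trans hl)
  | hadd x y hx hy =>
    obtain ⟨k, hk⟩ := hx
    obtain ⟨l, hl⟩ := hy
    exact ⟨max k l, fun i hi => by
      rw [map_add, hk i (le_trans (le_max_left _ _) hi), hl i (le_trans (le_max_right _ _) hi)]⟩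
  | hsmul r x hx =>
    obtain ⟨k, hk⟩ := hx
    exact ⟨k, fun i hi => by rw [map_smul, hk i hi]⟩

/-- Linear maps with arbitrarily prescribed components exist. -/
theorem exists_of_components {V : Type} [AddCommGroup V] [Module ℝ V] {m : ℕ}
    (s : ∀ κ : {κ : ℕ →₀ ℕ // κ.degree = m}, SymComp V κ.1) :
    ∃ L : Sym[ℝ]^m (Jets V) →ₗ[ℝ] V, ∀ κ, HasComponent L κ.1 (s κ) := by
  choose L hL hL' using fun κ => exists_single_component (m := m) κ.1 (s κ)
  -- Infinitely many `L κ` may be non-zero, but a given `x` has bounded degree `k`, and `L κ`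
  -- vanishes there as soon as `κ` involves a larger degree. The sum of the `L κ` is therefore
  -- finite at each point.
  have hfin : ∀ x, (Function.support fun κ => L κ x).Finite := fun x => by
    obtain ⟨k, hk⟩ := exists_symMap_jetsTrunc_eq x
    refine (finite_compositions m k).subset fun κ hκ => ?_
    by_contra hκ'
    refine hκ ?_
    have h0 : L κ ∘ₗ symMap m (jetsTrunc V k) = 0 :=
      eq_of_hasComponent (fun _ => 0) (fun κ' => by
        by_cases h : κ' = κ
        · subst h
          exact hasComponent_comp_jetsTrunc_zero _ hκ'
        · by_cases h' : ∀ i ∈ κ'.1.support, i ≤ k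
          · exact (hL' κ κ'.1 fun h'' => h (Subtype.ext h'')).comp_jetsTrunc h'
          · exact hasComponent_comp_jetsTrunc_zero _ h') (fun κ' e x => by simp)
    have := LinearMap.congr_fun h0 x
    rwa [LinearMap.comp_apply, hk k le_rfl] at this
  refine ⟨{ toFun := fun x => ∑ᶠ κ, L κ x
            map_add' := fun x y => by
              simp_rw [map_add]
              exact finsum_add_distrib (hfin x) (hfin y)
            map_smul' := fun r x => by
              simp_rw [map_smul]
              exact (smul_finsum' (f := fun κ => L κ x) r (hfin x)).symm }, fun κ e x => ?_⟩
  rw [hL κ e x]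
  refine (finsum_eq_single (fun κ' => L κ' _) κ fun κ' h => ?_).symm
  rw [← hL' κ' κ.1 (fun h' => h (Subtype.ext h'.symm)) e x, map_zero, LinearMap.zero_apply]

/-! ### Equivariance of the components -/

theorem symPairing_symMap {X Y : Type*} [AddCommMonoid X] [Module ℝ X] [AddCommMonoid Y]
    [Module ℝ Y] {B : X →ₗ[ℝ] Y →ₗ[ℝ] ℝ} {f : X →ₗ[ℝ] X} {g : Y →ₗ[ℝ] Y}
    (h : ∀ x y, B (f x) (g y) = B x y) (n : ℕ) (x : Sym[ℝ]^n X) (y : Sym[ℝ]^n Y) :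
    symPairing n B (symMap n f x) (symMap n g y) = symPairing n B x y := by
  induction x using sym_induction with
  | hadd x x' hx hx' => simp only [map_add, LinearMap.add_apply, hx, hx']
  | hsmul r x hx => simp only [map_smul, LinearMap.smul_apply, hx]
  | htprod x =>
    induction y using sym_induction with
    | hadd y y' hy hy' => simp only [map_add, hy, hy']
    | hsmul r y hy => simp only [map_smul, hy]
    | htprod y => simp only [symMap_tprod, symPairing_tprod, h]

theorem tensorPairing_map {ι : Type*} [Fintype ι] {X Y : ι → Type*} [∀ i, AddCommMonoid (X i)]
    [∀ i, Module ℝ (X i)] [∀ i, AddCommMonoid (Y i)] [∀ i, Module ℝ (Y i)]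
    {B : ∀ i, X i →ₗ[ℝ] Y i →ₗ[ℝ] ℝ} {f : ∀ i, X i →ₗ[ℝ] X i} {g : ∀ i, Y i →ₗ[ℝ] Y i}
    (h : ∀ i x y, B i (f i x) (g i y) = B i x y) (x : ⨂[ℝ] i, X i) (y : ⨂[ℝ] i, Y i) :
    tensorPairing B (PiTensorProduct.map f x) (PiTensorProduct.map g y) = tensorPairing B x y := by
  induction x using PiTensorProduct.induction_on with
  | add x x' hx hx' => simp only [map_add, LinearMap.add_apply, hx, hx']
  | smul_tprod r x =>
    induction y using PiTensorProduct.induction_on with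
    | add y y' hy hy' => simp only [map_add, hy, hy']
    | smul_tprod r' y =>
      simp only [map_smul, LinearMap.smul_apply, PiTensorProduct.map_tprod, tensorPairing_tprod, h]

theorem degreePairing_rep {G V : Type} [Group G] [AddCommMonoid V] [Module ℝ V]
    (ρ : Representation ℝ G V) (g : G) (j : ℕ) (x : Module.Dual ℝ V ⊗[ℝ] Sym[ℝ]^j V)
    (y : V ⊗[ℝ] Sym[ℝ]^j (Module.Dual ℝ V)) :
    degreePairing V j ((ρ.dual.tprod (symRep ρ j)) g x) ((ρ.tprod (symRep ρ.dual j)) g y)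
      = degreePairing V j x y := by
  induction x using TensorProduct.induction_on with
  | zero => simp
  | add x x' hx hx' => simp only [map_add, LinearMap.add_apply, hx, hx']
  | tmul ε s =>
    induction y using TensorProduct.induction_on with
    | zero => simp
    | add y y' hy hy' => simp only [map_add, hy, hy']
    | tmul e p =>
      rw [Representation.tprod_apply, Representation.tprod_apply, TensorProduct.map_tmul,
        TensorProduct.map_tmul, degreePairing_tmul, degreePairing_tmul]
      congr 1
      · simp [Representation.dual_apply, Module.Dual.transpose_apply]
      · exact symPairing_symMap (fun v ℓ => by
          simp [Representation.dual_apply, Module.Dual.transpose_apply]) j s p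

theorem contraction_rep {G V : Type} [Group G] [AddCommMonoid V] [Module ℝ V]
    (ρ : Representation ℝ G V) (g : G) (κ : ℕ →₀ ℕ) (s : SymComp V κ)
    (b : ⨂[ℝ] j : κ.support, Sym[ℝ]^(κ j) (V ⊗[ℝ] Sym[ℝ]^(j : ℕ) (Module.Dual ℝ V))) :
    contraction V κ (symCompRep ρ κ g s)
        (PiTensorProduct.map (fun j : κ.support =>
          symMap (κ j) ((ρ.tprod (symRep ρ.dual (j : ℕ))) g)) b)
      = ρ g (contraction V κ s b) := by
  induction s using TensorProduct.induction_on with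
  | zero => simp
  | add x y hx hy => simp only [map_add, LinearMap.add_apply, hx, hy]
  | tmul u a =>
    rw [symCompRep, Representation.tprod_apply, TensorProduct.map_tmul, contraction_tmul,
      contraction_tmul, map_smul]
    congr 1
    exact tensorPairing_map (fun (j : κ.support) x y => symPairing_symMap (degreePairing_rep ρ g (j : ℕ)) _ x y)
      a b

theorem jetsRep_jetsIncl {G V : Type} [Group G] [AddCommMonoid V] [Module ℝ V]
    (ρ : Representation ℝ G V) (g : G) (j : ℕ) (y : V ⊗[ℝ] Sym[ℝ]^j (Module.Dual ℝ V)) :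
    jetsRep ρ g (jetsIncl V j y) = jetsIncl V j ((ρ.tprod (symRep ρ.dual j)) g y) := by
  induction y using TensorProduct.induction_on with
  | zero => simp
  | add x y hx hy => simp only [map_add, hx, hy]
  | tmul u p =>
    simp only [jetsRep, jetsIncl, Representation.tprod_apply, LinearMap.lTensor_tmul,
      TensorProduct.map_tmul]
    congr 1
    exact DirectSum.lmap_lof _ _ _

/-- The contraction is equivariant because every pairing is built from evaluation, which is
invariant under an action together with its contragredient. -/
theorem HasComponent.conj {G V : Type} [Group G] [AddCommMonoid V] [Module ℝ V]
    (ρ : Representation ℝ G V) (g : G) {m : ℕ} {L : Sym[ℝ]^m (Jets V) →ₗ[ℝ] V} {κ : ℕ →₀ ℕ}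
    {s : SymComp V κ} (h : HasComponent L κ s) :
    HasComponent (ρ g ∘ₗ L ∘ₗ symRep (jetsRep ρ) m g⁻¹) κ (symCompRep ρ κ g s) := by
  intro e x
  have h1 := h e fun j r => (ρ.tprod (symRep ρ.dual (j : ℕ))) g⁻¹ (x j r)
  have h2 := contraction_rep ρ g κ s (PiTensorProduct.tprod ℝ fun j : κ.support =>
    SymmetricPower.tprod ℝ fun r => (ρ.tprod (symRep ρ.dual (j : ℕ))) g⁻¹ (x j r))
  simp only [PiTensorProduct.map_tprod, symMap_tprod, Representation.self_inv_apply] at h2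
  rw [h2, h1, LinearMap.comp_apply, LinearMap.comp_apply]
  change _ = ρ g (L (symMap m (jetsRep ρ g⁻¹) _))
  rw [symMap_tprod]
  simp_rw [jetsRep_jetsIncl]

theorem mem_equivariantLin_iff_conj {G V : Type} [Group G] [AddCommGroup V] [Module ℝ V]
    (ρ : Representation ℝ G V) {m : ℕ} {L : Sym[ℝ]^m (Jets V) →ₗ[ℝ] V} :
    L ∈ equivariantLin ρ m ↔ ∀ g, ρ g ∘ₗ L ∘ₗ symRep (jetsRep ρ) m g⁻¹ = L := by
  refine ⟨fun h g => LinearMap.ext fun w => ?_, fun h g w => ?_⟩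
  · rw [LinearMap.comp_apply, LinearMap.comp_apply, h g⁻¹ w, Representation.self_inv_apply]
  · conv_lhs => rw [← h g]
    rw [LinearMap.comp_apply, LinearMap.comp_apply, Representation.inv_self_apply]

/-- Equivariance is invariance under conjugation. Since a map and its components determine each
other, it can be tested on components. -/
theorem mem_equivariantLin_iff {G V : Type} [Group G] [AddCommGroup V] [Module ℝ V]
    [FiniteDimensional ℝ V] (ρ : Representation ℝ G V) {m : ℕ} {L : Sym[ℝ]^m (Jets V) →ₗ[ℝ] V}
    {s : ∀ κ : {κ : ℕ →₀ ℕ // κ.degree = m}, SymComp V κ.1} (h : ∀ κ, HasComponent L κ.1 (s κ)) :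
    L ∈ equivariantLin ρ m ↔ ∀ κ, s κ ∈ symCompInvariants ρ κ.1 := by
  rw [mem_equivariantLin_iff_conj]
  refine ⟨fun hL κ g => ?_, fun hs g => eq_of_hasComponent s (fun κ => ?_) h⟩
  · have := (h κ).conj ρ g
    rw [hL g] at this
    exact this.unique κ.2 (h κ)
  · rw [← hs κ g]
    exact (h κ).conj ρ g

/-- Equivariant linear maps correspond to families of invariant elements of the spaces `Sym_κ`. -/
theorem exists_equivariantLin_equiv_pi {G V : Type} [Group G] [AddCommGroup V] [Module ℝ V]
    [FiniteDimensional ℝ V] (ρ : Representation ℝ G V) (m : ℕ) :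
    ∃ D : equivariantLin ρ m ≃ₗ[ℝ]
        ((κ : {κ : ℕ →₀ ℕ // κ.degree = m}) → symCompInvariants ρ κ.1),
      ∀ L κ, HasComponent L.1 κ.1 (D L κ).1 := by
  refine exists_linearEquiv_of_rel
    (fun (L : equivariantLin ρ m)
      (t : (κ : {κ : ℕ →₀ ℕ // κ.degree = m}) → symCompInvariants ρ κ.1) =>
      ∀ κ, HasComponent L.1 κ.1 (t κ).1)
    (fun L L' t t' h h' κ => by
      have h'' : HasComponent (L.1 + L'.1) κ.1 ((t κ).1 + (t' κ).1) := (h κ).add (h' κ)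
      exact h'') (fun r L t h κ => by
      have h' : HasComponent (r • L.1) κ.1 (r • (t κ).1) := (h κ).smul r
      exact h')
    (fun L => ?_) (fun L t t' h h' => ?_) (fun t => ?_) (fun L L' t h h' => ?_)
  · choose s hs using fun κ : {κ : ℕ →₀ ℕ // κ.degree = m} => exists_hasComponent L.1 κ.2
    exact ⟨fun κ => ⟨s κ, (mem_equivariantLin_iff ρ hs).1 L.2 κ⟩, hs⟩
  · exact funext fun κ => Subtype.ext ((h κ).unique κ.2 (h' κ))
  · obtain ⟨L, hL⟩ := exists_of_components (m := m) fun κ => (t κ).1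
    exact ⟨⟨L, (mem_equivariantLin_iff ρ hL).2 fun κ => (t κ).2⟩, hL⟩
  · exact Subtype.ext (eq_of_hasComponent _ h h')

/-- Equivariant linear maps of finite order correspond to finitely supported families of invariant
elements of the spaces `Sym_κ`. -/
theorem exists_equivariantLinFin_equiv_directSum {G V : Type} [Group G] [AddCommGroup V]
    [Module ℝ V] [FiniteDimensional ℝ V] (ρ : Representation ℝ G V) (m : ℕ) :
    ∃ D : equivariantLinFin ρ m ≃ₗ[ℝ]
        ⨁ κ : {κ : ℕ →₀ ℕ // κ.degree = m}, symCompInvariants ρ κ.1,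
      ∀ L κ, HasComponent L.1 κ.1 (D L κ).1 := by
  classical
  refine exists_linearEquiv_of_rel
    (fun (L : equivariantLinFin ρ m)
      (t : ⨁ κ : {κ : ℕ →₀ ℕ // κ.degree = m}, symCompInvariants ρ κ.1) =>
      ∀ κ, HasComponent L.1 κ.1 (t κ).1)
    (fun L L' t t' h h' κ => by
      have h'' : HasComponent (L.1 + L'.1) κ.1 ((t κ).1 + (t' κ).1) := (h κ).add (h' κ)
      exact h'') (fun r L t h κ => by
      have h' : HasComponent (r • L.1) κ.1 (r • (t κ).1) := (h κ).smul r
      exact h')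
    (fun L => ?_) (fun L t t' h h' => ?_) (fun t => ?_) (fun L L' t h h' => ?_)
  · choose s hs using fun κ : {κ : ℕ →₀ ℕ // κ.degree = m} => exists_hasComponent L.1 κ.2
    obtain ⟨hL, k, hk⟩ := L.2
    let s' : (κ : {κ : ℕ →₀ ℕ // κ.degree = m}) → symCompInvariants ρ κ.1 :=
      fun κ => ⟨s κ, (mem_equivariantLin_iff ρ hs).1 hL κ⟩
    -- Components outside this finite set of compositions vanish because `L` has order `k`.
    refine ⟨DirectSum.mk _ (finite_compositions m k).toFinset fun κ => s' κ.1, fun κ => ?_⟩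
    by_cases hκ : κ ∈ (finite_compositions m k).toFinset
    · rw [DirectSum.mk_apply_of_mem hκ]
      exact hs κ
    · rw [DirectSum.mk_apply_of_notMem hκ]
      have := (hs κ).eq_zero_of_hasOrder hk κ.2 (by simpa using hκ)
      rw [Submodule.coe_zero, ← this]
      exact hs κ
  · exact DFinsupp.ext fun κ => Subtype.ext ((h κ).unique κ.2 (h' κ))
  · obtain ⟨L, hL⟩ := exists_of_components (m := m) fun κ => (t κ).1
    refine ⟨⟨L, (mem_equivariantLin_iff ρ hL).2 fun κ => (t κ).2,
      -- The order is the largest degree occurring in a composition with non-zero component.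
      (DFinsupp.support t).sup fun κ => κ.1.support.sup id,
      hasOrder_of_hasComponent hL fun κ hκ i hi => ?_⟩, hL⟩
    refine le_trans (Finset.le_sup (f := id) hi)
      (Finset.le_sup (f := fun κ : {κ : ℕ →₀ ℕ // κ.degree = m} => κ.1.support.sup id) ?_)
    rw [DFinsupp.mem_support_iff]
    exact fun h => hκ (by rw [h]; rfl)
  · exact Subtype.ext (eq_of_hasComponent _ h h')

/-! ### Cutting off flat functions -/

section Cutoff

variable {E F : Type*} [NormedAddCommGroup E] [NormedSpace ℝ E] [FiniteDimensional ℝ E]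
  [NormedAddCommGroup F] [NormedSpace ℝ F]

/-- Start from a bound for the derivative of order `k + 1` on the unit ball and descend: each lower
derivative vanishes at `0`, so the mean value inequality gains one factor `‖x‖` without changing the
constant. -/
theorem exists_bound_of_flat {f : E → F} (hf : ContDiff ℝ ∞ f) {k : ℕ}
    (hflat : ∀ n ≤ k, iteratedFDeriv ℝ n f 0 = 0) :
    ∃ C, 0 ≤ C ∧ ∀ i ≤ k + 1, ∀ x, ‖x‖ ≤ 1 →
      ‖iteratedFDeriv ℝ (k + 1 - i) f x‖ ≤ C * ‖x‖ ^ i := by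
  have hcont : ∀ n, Continuous (iteratedFDeriv ℝ n f) := fun n =>
    hf.continuous_iteratedFDeriv (by exact_mod_cast le_top)
  obtain ⟨C, hC⟩ := (isCompact_closedBall (0 : E) 1).exists_bound_of_continuousOn
    (hcont (k + 1)).continuousOn
  have hC0 : 0 ≤ C := (norm_nonneg _).trans (hC 0 (by simp))
  refine ⟨C, hC0, fun i => ?_⟩
  induction i with
  | zero => exact fun _ x hx => by simpa using hC x (by simpa using hx)
  | succ i ih =>
    intro hi x hx
    obtain ⟨j, hj⟩ : ∃ j, k + 1 - (i + 1) = j := ⟨_, rfl⟩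
    have hj' : k + 1 - i = j + 1 := by omega
    rw [hj]
    have hmv := (convex_closedBall (0 : E) ‖x‖).norm_image_sub_le_of_norm_fderiv_le
      (𝕜 := ℝ) (f := iteratedFDeriv ℝ j f) (C := C * ‖x‖ ^ i) (x := 0) (y := x)
      (fun y _ => (hf.differentiable_iteratedFDeriv (m := j)
        (by exact_mod_cast ENat.natCast_lt_top j)).differentiableAt)
      (fun y hy => by
        have hy' : ‖y‖ ≤ ‖x‖ := by simpa using hy
        rw [norm_fderiv_iteratedFDeriv, ← hj']
        refine (ih (by omega) y (hy'.trans hx)).trans ?_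
        gcongr) (by simp) (by simp)
    rw [hflat j (by omega), sub_zero, sub_zero] at hmv
    rwa [pow_succ, ← mul_assoc]

omit [FiniteDimensional ℝ E] in
theorem exists_bound_iteratedFDeriv {f : E → F} (hf : ContDiff ℝ ∞ f) (hc : HasCompactSupport f)
    (k : ℕ) : ∃ B, 0 ≤ B ∧ ∀ n ≤ k, ∀ x, ‖iteratedFDeriv ℝ n f x‖ ≤ B := by
  have h : ∀ n, ∃ B, ∀ x, ‖iteratedFDeriv ℝ n f x‖ ≤ B := fun n =>
    (hc.iteratedFDeriv n).exists_bound_of_continuous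
      (hf.continuous_iteratedFDeriv (by exact_mod_cast le_top))
  choose B hB using h
  have hB0 : ∀ n, 0 ≤ B n := fun n => (norm_nonneg _).trans (hB n 0)
  refine ⟨∑ n ∈ Finset.range (k + 1), B n, Finset.sum_nonneg fun n _ => hB0 n,
    fun n hn x => (hB n x).trans ?_⟩
  exact Finset.single_le_sum (fun n _ => hB0 n) (Finset.mem_range.2 (by omega))

variable (E) in
/-- There is a smooth function which is `1` on the ball of radius `1 / 2` and vanishes outside the
unit ball. -/
theorem exists_cutoff : ∃ χ : E → ℝ, ContDiff ℝ ∞ χ ∧ HasCompactSupport χ ∧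
    (∀ x, ‖x‖ ≤ 1 / 2 → χ x = 1) ∧ ∀ x, 1 ≤ ‖x‖ → χ x = 0 := by
  let b : ContDiffBump (0 : E) := ⟨1 / 2, 1, by norm_num, by norm_num⟩
  refine ⟨b, b.contDiff, b.hasCompactSupport, fun x hx => b.one_of_mem_closedBall (by
    simpa [b] using hx), fun x hx => b.zero_of_le_dist (by simpa [b] using hx)⟩

/-- Multiply by the cut-off `χ (x / r)`. In the Leibniz formula, `i` derivatives of the cut-off cost
`r⁻ⁱ`, while flatness bounds the complementary derivative of `f` by a multiple of `r^(i + 1)`. One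
factor `r` is left over and makes everything small. -/
theorem exists_cutoff_of_flat {f : E → F} (hf : ContDiff ℝ ∞ f) {k : ℕ}
    (hflat : ∀ n ≤ k, iteratedFDeriv ℝ n f 0 = 0) {R ε : ℝ} (hR : 0 < R) (hε : 0 < ε) :
    ∃ g : E → F, ContDiff ℝ ∞ g ∧ g =ᶠ[𝓝 0] f ∧ (∀ x, R ≤ ‖x‖ → g x = 0) ∧
      ∀ n ≤ k, ∀ x, ‖iteratedFDeriv ℝ n g x‖ ≤ ε := by
  obtain ⟨χ, hχ, hχc, hχ1, hχ0⟩ := exists_cutoff E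
  obtain ⟨C, hC0, hC⟩ := exists_bound_of_flat hf hflat
  obtain ⟨B, hB0, hB⟩ := exists_bound_iteratedFDeriv hχ hχc k
  -- The factor `2 ^ k` bounds the sum of the binomial coefficients, `B` bounds the cut-off and `C`
  -- the flat function.
  obtain ⟨r, hr0, hr1, hrR, hrε⟩ : ∃ r : ℝ, 0 < r ∧ r ≤ 1 ∧ r ≤ R ∧ 2 ^ k * B * C * r ≤ ε := by
    have hM : 0 < 2 ^ k * B * C + 1 := by positivity
    refine ⟨min (min 1 R) (ε / (2 ^ k * B * C + 1)), by positivity,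
      (min_le_left _ _).trans (min_le_left _ _), (min_le_left _ _).trans (min_le_right _ _), ?_⟩
    calc 2 ^ k * B * C * min (min 1 R) (ε / (2 ^ k * B * C + 1))
        ≤ (2 ^ k * B * C + 1) * (ε / (2 ^ k * B * C + 1)) := by
          gcongr
          · linarith
          · exact min_le_right _ _
      _ = ε := by field_simp
  let χr : E → ℝ := fun x => χ (r⁻¹ • x)
  have hχr : ContDiff ℝ ∞ χr := hχ.comp (contDiff_const_smul _)
  have hnorm : ∀ x : E, ‖r⁻¹ • x‖ = r⁻¹ * ‖x‖ := fun x => by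
    rw [norm_smul, Real.norm_of_nonneg (inv_nonneg.2 hr0.le)]
  have hzero : ∀ x : E, r ≤ ‖x‖ → χr x = 0 := fun x hx => hχ0 _ (by
    rw [hnorm, ← div_eq_inv_mul, le_div_iff₀ hr0]; linarith)
  refine ⟨fun x => χr x • f x, hχr.smul hf, ?_, fun x hx => ?_, fun n hn x => ?_⟩
  · filter_upwards [Metric.closedBall_mem_nhds (0 : E) (half_pos hr0)] with x hx
    have hx' : ‖x‖ ≤ r / 2 := by simpa using hx
    have : χr x = 1 := hχ1 _ (by
      rw [hnorm, ← div_eq_inv_mul, div_le_iff₀ hr0]; linarith)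
    simp [this]
  · simp [hzero x (hrR.trans hx)]
  · by_cases hx : ‖x‖ ≤ r
    · have hx1 := hx.trans hr1
      refine (norm_iteratedFDeriv_smul_le hχr hf x (n := n) (by exact_mod_cast le_top)).trans ?_
      have hterm : ∀ i ∈ Finset.range (n + 1), (n.choose i : ℝ) * ‖iteratedFDeriv ℝ i χr x‖ *
          ‖iteratedFDeriv ℝ (n - i) f x‖ ≤ n.choose i * (B * C * r) := fun i hi => by
        have hi' : i ≤ n := by simpa [Nat.lt_succ_iff] using hi
        have h1 : ‖iteratedFDeriv ℝ i χr x‖ ≤ r⁻¹ ^ i * B := by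
          rw [iteratedFDeriv_comp_const_smul (i := i) _ (hχ.of_le (by exact_mod_cast le_top)),
            norm_smul, norm_pow, Real.norm_of_nonneg (inv_nonneg.2 hr0.le)]
          gcongr
          exact hB i (hi'.trans hn) _
        have h2 : ‖iteratedFDeriv ℝ (n - i) f x‖ ≤ C * r ^ (i + 1) := by
          have := hC (k + 1 - (n - i)) (by omega) x hx1
          rw [show k + 1 - (k + 1 - (n - i)) = n - i by omega] at this
          refine this.trans (mul_le_mul_of_nonneg_left ?_ hC0)
          calc ‖x‖ ^ (k + 1 - (n - i)) ≤ r ^ (k + 1 - (n - i)) := by gcongr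
            _ ≤ r ^ (i + 1) := pow_le_pow_of_le_one hr0.le hr1 (by omega)
        calc (n.choose i : ℝ) * ‖iteratedFDeriv ℝ i χr x‖ * ‖iteratedFDeriv ℝ (n - i) f x‖
            ≤ n.choose i * (r⁻¹ ^ i * B) * (C * r ^ (i + 1)) := by gcongr
          _ = n.choose i * (B * C * r) := by
            rw [pow_succ, inv_pow]
            field_simp
      refine (Finset.sum_le_sum hterm).trans ?_
      rw [← Finset.sum_mul, ← Nat.cast_sum, Nat.sum_range_choose]
      refine le_trans ?_ hrε
      push_cast
      have : (2 : ℝ) ^ n ≤ 2 ^ k := pow_le_pow_right₀ (by norm_num) hn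
      calc (2 : ℝ) ^ n * (B * C * r) ≤ 2 ^ k * (B * C * r) := by gcongr
        _ = 2 ^ k * B * C * r := by ring
    · have : iteratedFDeriv ℝ n (fun x => χr x • f x) x = 0 := by
        refine (Filter.EventuallyEq.iteratedFDeriv ℝ (f₂ := fun _ => (0 : F)) ?_ n).eq_of_nhds.trans
          (by simp)
        filter_upwards [(isOpen_lt continuous_const continuous_norm).mem_nhds (not_le.1 hx)] with y hy
        simp [hzero y (le_of_lt hy)]
      rw [this, norm_zero]
      exact hε.le

/-- Without flatness, shrinking the cut-off does not make derivatives small; a small scalar multiple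
does. This handles the arguments other than the flat one. -/
theorem exists_small_cutoff {f : E → F} (hf : ContDiff ℝ ∞ f) (k : ℕ) {R ε : ℝ} (hR : 0 < R)
    (hε : 0 < ε) :
    ∃ c : ℝ, 0 < c ∧ ∃ g : E → F, ContDiff ℝ ∞ g ∧ g =ᶠ[𝓝 0] (fun x => c • f x) ∧
      (∀ x, R ≤ ‖x‖ → g x = 0) ∧ ∀ n ≤ k, ∀ x, ‖iteratedFDeriv ℝ n g x‖ ≤ ε := by
  obtain ⟨χ, hχ, hχc, hχ1, hχ0⟩ := exists_cutoff E
  have hnorm : ∀ x : E, ‖R⁻¹ • x‖ = R⁻¹ * ‖x‖ := fun x => by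
    rw [norm_smul, Real.norm_of_nonneg (inv_nonneg.2 hR.le)]
  let h : E → F := fun x => χ (R⁻¹ • x) • f x
  have hh : ContDiff ℝ ∞ h := (hχ.comp (contDiff_const_smul _)).smul hf
  have hh0 : ∀ x, R ≤ ‖x‖ → h x = 0 := fun x hx => by
    have : χ (R⁻¹ • x) = 0 := hχ0 _ (by
      rw [hnorm, ← div_eq_inv_mul, le_div_iff₀ hR]; linarith)
    simp [h, this]
  have hhc : HasCompactSupport h := by
    refine HasCompactSupport.intro (isCompact_closedBall (0 : E) R) fun x hx => hh0 x ?_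
    have : ¬ ‖x‖ ≤ R := by simpa using hx
    exact (not_le.1 this).le
  obtain ⟨B, hB0, hB⟩ := exists_bound_iteratedFDeriv hh hhc k
  have hc : 0 < ε / (B + 1) := by positivity
  refine ⟨ε / (B + 1), hc, fun x => (ε / (B + 1)) • h x, hh.const_smul _, ?_, fun x hx => ?_,
    fun n hn x => ?_⟩
  · filter_upwards [Metric.closedBall_mem_nhds (0 : E) (half_pos hR)] with x hx
    have hx' : ‖x‖ ≤ R / 2 := by simpa using hx
    have : χ (R⁻¹ • x) = 1 := hχ1 _ (by
      rw [hnorm, ← div_eq_inv_mul, div_le_iff₀ hR]; linarith)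
    simp [h, this]
  · simp [hh0 x hx]
  · rw [iteratedFDeriv_const_smul_apply' (hh.of_le (by exact_mod_cast le_top)).contDiffAt,
      norm_smul, Real.norm_of_nonneg hc.le]
    calc ε / (B + 1) * ‖iteratedFDeriv ℝ n h x‖ ≤ ε / (B + 1) * (B + 1) := by
          gcongr
          exact (hB n hn x).trans (by linarith)
      _ = ε := by field_simp

end Cutoff

/-! ### Local operators have finite order -/

theorem VField.ext {d : ℕ} {f g : VField d} (h : ∀ x, f x = g x) : f = g :=
  Subtype.ext (funext h)

/-- Evaluation of vector fields at a point. -/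
def evalAt {d : ℕ} (x : Fin d → ℝ) : VField d →ₗ[ℝ] (Fin d → ℝ) where
  toFun f := f x
  map_add' _ _ := rfl
  map_smul' _ _ := rfl

theorem affineAct_one_apply {d : ℕ} (b : Fin d → ℝ) (f : VField d) (x : Fin d → ℝ) :
    affineAct 1 b f x = f (x - b) := by
  simp [affineAct]

theorem IsLocal.apply_eq_zero {d m : ℕ}
    {φ : MultilinearMap ℝ (fun _ : Fin m => VField d) (VField d)} (hφ : IsLocal φ)
    {f : Fin m → VField d} {x : Fin d → ℝ} (i : Fin m) (h : ∀ᶠ y in 𝓝 x, f i y = 0) :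
    φ f x = 0 := by
  refine image_eq_zero_of_notMem_tsupport fun hx => ?_
  exact (notMem_tsupport_iff_eventuallyEq.2 h) (hφ f i hx)

/-- The arguments are exchanged one at a time; each exchange changes the value by `φ` of a tuple
with one entry vanishing near `x`. -/
theorem IsLocal.congr {d m : ℕ}
    {φ : MultilinearMap ℝ (fun _ : Fin m => VField d) (VField d)} (hφ : IsLocal φ)
    {f g : Fin m → VField d} {x : Fin d → ℝ} (h : ∀ i, ∀ᶠ y in 𝓝 x, f i y = g i y) :
    φ f x = φ g x := by
  classical
  have key : ∀ s : Finset (Fin m), φ (s.piecewise f g) x = φ g x := fun s => by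
    induction s using Finset.induction_on with
    | empty => simp
    | insert a s ha ih =>
      rw [← ih, Finset.piecewise_insert]
      have h0 := hφ.apply_eq_zero (f := Function.update (s.piecewise f g) a (f a - g a)) (x := x) a (by
        filter_upwards [h a] with y hy
        rw [Function.update_self]
        exact sub_eq_zero.2 hy)
      rw [MultilinearMap.map_update_sub] at h0
      have h1 : Function.update (s.piecewise f g) a (g a) = s.piecewise f g := by
        rw [Function.update_eq_self_iff]
        simp [ha]
      rw [h1] at h0
      exact sub_eq_zero.1 h0
  simpa using key Finset.univ

/-- The derivatives up to order `k` at the origin vanish. -/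
def IsFlat {d : ℕ} (k : ℕ) (f : VField d) : Prop := ∀ n ≤ k, iteratedFDeriv ℝ n f 0 = 0

/-- The other arguments are scaled down by the `c j`. The flat one may be scaled by any constant
before being cut off, so it compensates for them and brings the value at the origin to norm `k`. -/
theorem IsLocal.exists_localized {d m k : ℕ}
    {φ : MultilinearMap ℝ (fun _ : Fin m => VField d) (VField d)} (hφ : IsLocal φ)
    {f : Fin m → VField d} {i : Fin m} (hi : IsFlat k (f i)) (h : φ f 0 ≠ 0) {R ε : ℝ}
    (hR : 0 < R) (hε : 0 < ε) :
    ∃ g : Fin m → VField d, (∀ j x, R ≤ ‖x‖ → g j x = 0) ∧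
      (∀ j, ∀ n ≤ k, ∀ x, ‖iteratedFDeriv ℝ n (g j) x‖ ≤ ε) ∧ (k : ℝ) ≤ ‖φ g 0‖ := by
  classical
  choose c hc g hg hgf hgR hgε using fun j => exists_small_cutoff (f j).contDiff k hR hε
  have hprod : 0 < ∏ j, c j := Finset.prod_pos fun j _ => hc j
  have hne : 0 < ‖φ f 0‖ := norm_pos_iff.2 h
  -- Chosen so that the product of all scaling factors equals `k / ‖φ f 0‖`.
  let C : ℝ := k * c i / ((∏ j, c j) * ‖φ f 0‖)
  have hflat : ∀ n ≤ k, iteratedFDeriv ℝ n (fun x => C • f i x) 0 = 0 := fun n hn => by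
    rw [iteratedFDeriv_const_smul_apply' ((f i).contDiff.of_le
      (by exact_mod_cast le_top)).contDiffAt, hi n hn, smul_zero]
  obtain ⟨gi, hgi, hgif, hgiR, hgiε⟩ := exists_cutoff_of_flat ((f i).contDiff.const_smul C)
    hflat hR hε
  let G : Fin m → VField d := fun j => if j = i then ⟨gi, hgi⟩ else ⟨g j, hg j⟩
  let c' : Fin m → ℝ := fun j => if j = i then C else c j
  refine ⟨G, fun j x hx => ?_, fun j n hn x => ?_, ?_⟩
  · by_cases hj : j = i
    · simpa [G, hj] using hgiR x hx
    · simpa [G, hj] using hgR j x hx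
  · by_cases hj : j = i
    · simpa [G, hj] using hgiε n hn x
    · simpa [G, hj] using hgε j n hn x
  · have h1 : φ G 0 = φ (fun j => c' j • f j) 0 := hφ.congr fun j => by
      by_cases hj : j = i
      · subst hj
        simp only [G, c', if_true]
        exact hgif
      · simp only [G, c', hj, if_false]
        exact hgf j
    have h2 : φ (fun j => c' j • f j) 0 = (∏ j, c' j) • φ f 0 := by
      rw [MultilinearMap.map_smul_univ]; rfl
    have h3 : c i * ∏ j, c' j = C * ∏ j, c j := by
      rw [← Finset.mul_prod_erase _ c' (Finset.mem_univ i),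
        ← Finset.mul_prod_erase _ c (Finset.mem_univ i)]
      have : ∏ j ∈ Finset.univ.erase i, c' j = ∏ j ∈ Finset.univ.erase i, c j :=
        Finset.prod_congr rfl fun j hj => by simp [c', Finset.ne_of_mem_erase hj]
      rw [this]
      simp only [c', if_true]
      ring
    have h4 : ∏ j, c' j = k / ‖φ f 0‖ := by
      have hci := (hc i).ne'
      apply mul_left_cancel₀ hci
      rw [h3]
      simp only [C]
      field_simp
    rw [h1, h2, h4, norm_smul, Real.norm_of_nonneg (by positivity), div_mul_cancel₀ _ hne.ne']

theorem exists_separated_points {d : ℕ} {v : Fin d → ℝ} (hv : v ≠ 0) :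
    ∃ (p : ℕ → Fin d → ℝ) (R : ℕ → ℝ), (∀ k, 0 < R k) ∧ Filter.Tendsto p Filter.atTop (𝓝 0) ∧
      ∀ k l, k ≠ l → ∀ y, ‖y - p k‖ < R k → R l ≤ ‖y - p l‖ := by
  have hv0 : 0 < ‖v‖ := norm_pos_iff.2 hv
  let q : ℕ → ℝ := fun k => (1 / 2) ^ k
  have hq0 : ∀ k, 0 < q k := fun k => by positivity
  have hq : ∀ k l, k < l → q l ≤ q k / 2 := fun k l h => by
    have : q l ≤ q (k + 1) := pow_le_pow_of_le_one (by norm_num) (by norm_num) h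
    refine this.trans (le_of_eq ?_)
    simp only [q, pow_succ]
    ring
  -- The centres are `2⁻ᵏ v`. Two of them are at least a third of the sum of their norms apart, so a
  -- quarter of the norm is a safe radius.
  refine ⟨fun k => q k • v, fun k => q k * ‖v‖ / 4, fun k => by have := hq0 k; positivity, ?_,
    fun k l hkl y hy => ?_⟩
  · have : Filter.Tendsto q Filter.atTop (𝓝 0) :=
      tendsto_pow_atTop_nhds_zero_of_lt_one (by norm_num) (by norm_num)
    simpa using this.smul_const v
  · have h1 : |q k - q l| * ‖v‖ ≤ ‖y - q k • v‖ + ‖y - q l • v‖ := by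
      rw [← Real.norm_eq_abs, ← norm_smul, sub_smul]
      calc ‖q k • v - q l • v‖ = ‖(y - q l • v) - (y - q k • v)‖ := by congr 1; abel
        _ ≤ _ := (norm_sub_le _ _).trans (by linarith)
    have h2 : (q k + q l) / 3 ≤ |q k - q l| := by
      rcases lt_or_gt_of_ne hkl with h | h
      · have := hq k l h
        have := le_abs_self (q k - q l)
        linarith
      · have := hq l k h
        have := neg_abs_le (q k - q l)
        linarith
    have h3 := mul_le_mul_of_nonneg_right h2 hv0.le
    have h4 := mul_pos (hq0 k) hv0
    have h5 := mul_pos (hq0 l) hv0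
    nlinarith

/-- **Peetre's theorem** for multilinear translation equivariant operators: the value at the origin
vanishes if one of the arguments is flat of sufficiently high order. -/
theorem IsLocal.exists_order {d m : ℕ}
    {φ : MultilinearMap ℝ (fun _ : Fin m => VField d) (VField d)} (hφ : IsLocal φ)
    (htr : ∀ b f, φ (fun i => affineAct 1 b (f i)) = affineAct 1 b (φ f)) :
    ∃ k, ∀ (f : Fin m → VField d) (i : Fin m), IsFlat k (f i) → φ f 0 = 0 := by
  suffices H : ∀ i : Fin m, ∃ k, ∀ f : Fin m → VField d, IsFlat k (f i) → φ f 0 = 0 by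
    choose k hk using H
    exact ⟨Finset.univ.sup k, fun f i hi => hk i f fun n hn =>
      hi n (hn.trans (Finset.le_sup (Finset.mem_univ i)))⟩
  intro i
  by_contra! H
  choose f hflat hne using H
  -- The non-zero value `φ (f 0) 0` only serves as a direction along which to place the points; its
  -- existence excludes `d = 0`.
  obtain ⟨p, R, hR, hp, hsep⟩ := exists_separated_points (hne 0)
  choose g hgR hgε hgφ using fun k => hφ.exists_localized (hflat k) (hne k) (hR k)
    (show (0 : ℝ) < (1 / 2) ^ k by positivity)
  let T : ℕ → Fin m → VField d := fun k j => affineAct 1 (p k) (g k j)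
  have hT : ∀ k j x, T k j x = g k j (x - p k) := fun k j x => affineAct_one_apply _ _ _
  have hsmooth : ∀ j, ContDiff ℝ ∞ fun x => ∑' k, T k j x := fun j => by
    -- The bound `2⁻ᵏ` for the `n`-th derivative is available only for `k ≥ n`, which suffices for
    -- smoothness of the sum.
    refine contDiff_tsum_of_eventually (v := fun _ k => (1 / 2 : ℝ) ^ k) (N := ⊤)
      (fun k => (T k j).contDiff)
      (fun _ _ => summable_geometric_of_lt_one (by norm_num) (by norm_num)) fun n _ => ?_
    rw [Nat.cofinite_eq_atTop]
    filter_upwards [Filter.eventually_ge_atTop n] with k hk x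
    have : (T k j : (Fin d → ℝ) → Fin d → ℝ) = fun x => g k j (x - p k) := funext (hT k j)
    rw [this, iteratedFDeriv_comp_sub]
    exact hgε k j n hk _
  let S : Fin m → VField d := fun j => ⟨fun x => ∑' k, T k j x, hsmooth j⟩
  have hS : ∀ k, φ S (p k) = φ (g k) 0 := fun k => by
    -- Near `p k` every other summand vanishes, so locality discards it.
    have h1 : φ S (p k) = φ (T k) (p k) := hφ.congr fun j => by
      filter_upwards [Metric.ball_mem_nhds (p k) (hR k)] with y hy
      rw [Metric.mem_ball, dist_eq_norm] at hy
      refine tsum_eq_single k fun l hl => ?_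
      rw [hT]
      exact hgR l j _ (hsep k l hl.symm y hy)
    rw [h1, htr, affineAct_one_apply, sub_self]
  have hlim : Filter.Tendsto (fun k => ‖φ S (p k)‖) Filter.atTop (𝓝 ‖φ S 0‖) :=
    (((φ S).contDiff.continuous.tendsto 0).comp hp).norm
  have hlim' : Filter.Tendsto (fun k => ‖φ S (p k)‖) Filter.atTop Filter.atTop := by
    refine Filter.tendsto_atTop_mono (fun k => ?_) tendsto_natCast_atTop_atTop
    rw [hS]
    exact hgφ k
  exact not_tendsto_nhds_of_tendsto_atTop hlim' _ hlim

/-! ### Polynomial vector fields -/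

/-- An additive property of elements of `V ⊗ Sym V*` holds if it holds for all `u ⊗ ℓ₁ ⋯ ℓⱼ`. -/
theorem jets_induction {V : Type} [AddCommMonoid V] [Module ℝ V] {p : Jets V → Prop}
    (hzero : p 0) (hadd : ∀ x y, p x → p y → p (x + y))
    (hpure : ∀ (u : V) (j : ℕ) (ℓ : Fin j → Module.Dual ℝ V),
      p (u ⊗ₜ DirectSum.lof ℝ ℕ (fun j => Sym[ℝ]^j (Module.Dual ℝ V)) j (SymmetricPower.tprod ℝ ℓ)))
    (w : Jets V) : p w := by
  induction w using TensorProduct.induction_on with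
  | zero => exact hzero
  | add x y hx hy => exact hadd x y hx hy
  | tmul u s =>
    induction s using DirectSum.induction_on with
    | zero => rwa [TensorProduct.tmul_zero]
    | add x y hx hy => rw [TensorProduct.tmul_add]; exact hadd _ _ hx hy
    | of j s =>
      change p (u ⊗ₜ DirectSum.lof ℝ ℕ (fun j => Sym[ℝ]^j (Module.Dual ℝ V)) j s)
      induction s using sym_induction generalizing u with
      | htprod ℓ => exact hpure u j ℓ
      | hadd x y hx hy => rw [map_add, TensorProduct.tmul_add]; exact hadd _ _ (hx u) (hy u)
      | hsmul r x hx => rw [map_smul, TensorProduct.tmul_smul, TensorProduct.smul_tmul']; exact hx _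

/-- Evaluation of polynomial functions at a point. -/
noncomputable def evalPoly {V : Type} [AddCommMonoid V] [Module ℝ V] (x : V) : SymDual V →ₗ[ℝ] ℝ :=
  DirectSum.toModule ℝ ℕ ℝ fun j =>
    symLift ((MultilinearMap.mkPiAlgebra ℝ (Fin j) ℝ).compLinearMap
      fun _ => Module.Dual.eval ℝ V x) (fun σ ℓ => by
        simpa using Fintype.prod_equiv σ _ (fun i => ℓ i x) fun i => rfl)

/-- Evaluation of polynomial vector fields at a point. -/
noncomputable def evalJet {V : Type} [AddCommMonoid V] [Module ℝ V] (x : V) : Jets V →ₗ[ℝ] V :=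
  (TensorProduct.rid ℝ V).toLinearMap ∘ₗ LinearMap.lTensor V (evalPoly x)

theorem evalJet_tmul {V : Type} [AddCommMonoid V] [Module ℝ V] (x u : V) (j : ℕ)
    (ℓ : Fin j → Module.Dual ℝ V) :
    evalJet x (u ⊗ₜ DirectSum.lof ℝ ℕ (fun j => Sym[ℝ]^j (Module.Dual ℝ V)) j
      (SymmetricPower.tprod ℝ ℓ)) = (∏ i, ℓ i x) • u := by
  simp [evalJet, evalPoly, DirectSum.toModule_lof]

theorem jetsRep_tmul {G V : Type} [Group G] [AddCommMonoid V] [Module ℝ V]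
    (ρ : Representation ℝ G V) (g : G) (u : V) (j : ℕ) (ℓ : Fin j → Module.Dual ℝ V) :
    jetsRep ρ g (u ⊗ₜ DirectSum.lof ℝ ℕ (fun j => Sym[ℝ]^j (Module.Dual ℝ V)) j
      (SymmetricPower.tprod ℝ ℓ)) = ρ g u ⊗ₜ DirectSum.lof ℝ ℕ
        (fun j => Sym[ℝ]^j (Module.Dual ℝ V)) j
          (SymmetricPower.tprod ℝ fun i => ρ.dual g (ℓ i)) := by
  have := jetsRep_jetsIncl ρ g j (u ⊗ₜ SymmetricPower.tprod ℝ ℓ)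
  simp only [jetsIncl, LinearMap.lTensor_tmul, Representation.tprod_apply,
    TensorProduct.map_tmul] at this
  rw [this]
  congr 2
  exact symMap_tprod _ _ _

theorem evalJet_jetsRep {G V : Type} [Group G] [AddCommMonoid V] [Module ℝ V]
    (ρ : Representation ℝ G V) (g : G) (x : V) (w : Jets V) :
    evalJet x (jetsRep ρ g w) = ρ g (evalJet (ρ g⁻¹ x) w) := by
  induction w using jets_induction with
  | hzero => simp
  | hadd x y hx hy => simp only [map_add, hx, hy]
  | hpure u j ℓ =>
    rw [jetsRep_tmul, evalJet_tmul, evalJet_tmul, map_smul]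
    simp [Representation.dual_apply, Module.Dual.transpose_apply]

theorem jetsTrunc_tmul_of_le {V : Type} [AddCommMonoid V] [Module ℝ V] {j k : ℕ} (h : j ≤ k)
    (u : V) (s : Sym[ℝ]^j (Module.Dual ℝ V)) :
    jetsTrunc V k (u ⊗ₜ DirectSum.lof ℝ ℕ (fun j => Sym[ℝ]^j (Module.Dual ℝ V)) j s)
      = u ⊗ₜ DirectSum.lof ℝ ℕ (fun j => Sym[ℝ]^j (Module.Dual ℝ V)) j s :=
  jetsTrunc_jetsIncl_of_le h (u ⊗ₜ s)

theorem jetsTrunc_tmul_of_lt {V : Type} [AddCommMonoid V] [Module ℝ V] {j k : ℕ} (h : k < j)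
    (u : V) (s : Sym[ℝ]^j (Module.Dual ℝ V)) :
    jetsTrunc V k (u ⊗ₜ DirectSum.lof ℝ ℕ (fun j => Sym[ℝ]^j (Module.Dual ℝ V)) j s) = 0 :=
  jetsTrunc_jetsIncl_of_lt h (u ⊗ₜ s)

theorem jetsTrunc_jetsRep {G V : Type} [Group G] [AddCommMonoid V] [Module ℝ V]
    (ρ : Representation ℝ G V) (g : G) (k : ℕ) (w : Jets V) :
    jetsTrunc V k (jetsRep ρ g w) = jetsRep ρ g (jetsTrunc V k w) := by
  induction w using jets_induction with
  | hzero => simp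
  | hadd x y hx hy => simp only [map_add, hx, hy]
  | hpure u j ℓ =>
    rcases le_or_gt j k with h | h
    · rw [jetsRep_tmul, jetsTrunc_tmul_of_le h, jetsTrunc_tmul_of_le h, jetsRep_tmul]
    · rw [jetsRep_tmul, jetsTrunc_tmul_of_lt h, jetsTrunc_tmul_of_lt h, map_zero]

theorem contDiff_evalJet {d : ℕ} (w : Jets (Fin d → ℝ)) :
    ContDiff ℝ ∞ fun x : Fin d → ℝ => evalJet x w := by
  induction w using jets_induction with
  | hzero => simpa using contDiff_const
  | hadd x y hx hy => simpa using hx.add hy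
  | hpure u j ℓ =>
    simp_rw [evalJet_tmul]
    exact (contDiff_prod fun i _ => (LinearMap.toContinuousLinearMap (ℓ i)).contDiff).smul
      contDiff_const

/-- The vector field whose coefficients are the polynomials encoded by an element of
`V ⊗ Sym V*`. -/
noncomputable def polyField (d : ℕ) : Jets (Fin d → ℝ) →ₗ[ℝ] VField d where
  toFun w := ⟨fun x => evalJet x w, contDiff_evalJet w⟩
  map_add' w w' := VField.ext fun x => map_add (evalJet x) w w'
  map_smul' r w := VField.ext fun x => map_smul (evalJet x) r w

theorem polyField_apply {d : ℕ} (w : Jets (Fin d → ℝ)) (x : Fin d → ℝ) :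
    polyField d w x = evalJet x w := rfl

theorem polyField_jetsRep {d : ℕ} {H : Subgroup (GL (Fin d) ℝ)} (A : H) (w : Jets (Fin d → ℝ)) :
    polyField d (jetsRep (stdRep H) A w) = affineAct A.1 0 (polyField d w) :=
  VField.ext fun x => by
    rw [polyField_apply, evalJet_jetsRep]
    simp [affineAct, polyField_apply, stdRep]

/-! ### Derivatives of homogeneous polynomials -/

section Homogeneous

variable {E F : Type*} [NormedAddCommGroup E] [NormedSpace ℝ E] [NormedAddCommGroup F]
  [NormedSpace ℝ F]

/-- The function is its own power series at `0`, with `M` as the only non-zero term, so its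
derivative of order `n ≠ j` symmetrises zero. -/
theorem iteratedFDeriv_diagonal_of_ne [CompleteSpace F] {j n : ℕ} (hn : n ≠ j)
    (M : ContinuousMultilinearMap ℝ (fun _ : Fin j => E) F) :
    iteratedFDeriv ℝ n (fun x => M fun _ => x) 0 = 0 := by
  classical
  let p : FormalMultilinearSeries ℝ E F := fun n =>
    if h : n = j then M.domDomCongr (finCongr h.symm) else 0
  have hp : ∀ i, i ≠ j → p i = 0 := fun i hi => by simp [p, hi]
  have hpj : ∀ v, p j v = M v := fun v => by simp [p]
  have hrad : p.radius = ⊤ := p.radius_eq_top_of_forall_image_add_eq_zero (j + 1) fun i =>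
    hp _ (by omega)
  have hser : HasFPowerSeriesOnBall (fun x => M fun _ => x) p 0 ⊤ :=
    { r_le := hrad.ge
      r_pos := by simp
      hasSum := fun {y} _ => by
        have := hasSum_single (f := fun n => p n fun _ => y) j fun i hi => by rw [hp i hi]; rfl
        rw [hpj] at this
        simpa using this }
  ext v
  rw [hser.iteratedFDeriv_eq_sum_of_completeSpace, hp n hn]
  simp

/-- Induction on the order. A swap of the first two arguments is the symmetry of the second
derivative of a lower-order derivative; any later swap happens inside the function being
differentiated last. -/
theorem iteratedFDeriv_comp_swap {f : E → F} (hf : ContDiff ℝ ∞ f) (n : ℕ) (i : Fin n) (x : E)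
    (v : Fin (n + 1) → E) :
    iteratedFDeriv ℝ (n + 1) f x (fun t => v (Equiv.swap i.castSucc i.succ t))
      = iteratedFDeriv ℝ (n + 1) f x v := by
  have hdiff : ∀ n x, DifferentiableAt ℝ (iteratedFDeriv ℝ n f) x := fun n x =>
    (hf.differentiable_iteratedFDeriv (by exact_mod_cast ENat.natCast_lt_top n)).differentiableAt
  induction n generalizing x with
  | zero => exact i.elim0
  | succ n ih =>
    induction i using Fin.cases with
    | zero =>
      have hg : ∀ v : Fin n → E, ContDiff ℝ ∞ fun y => iteratedFDeriv ℝ n f y v := fun v =>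
        (ContinuousMultilinearMap.apply ℝ (fun _ : Fin n => E) F v).contDiff.comp
          (hf.iteratedFDeriv_right (m := ∞) (by exact_mod_cast le_top))
      have key : ∀ v : Fin (n + 1 + 1) → E, iteratedFDeriv ℝ (n + 1 + 1) f x v =
          fderiv ℝ (fderiv ℝ fun y => iteratedFDeriv ℝ n f y fun t => v t.succ.succ) x
            (v 0) (v 1) := fun v => by
        rw [(hdiff (n + 1) x).iteratedFDeriv_succ_apply_left']
        have : (fun y => iteratedFDeriv ℝ (n + 1) f y (Fin.tail v)) = fun y =>
            fderiv ℝ (fun y => iteratedFDeriv ℝ n f y fun t => v t.succ.succ) y (v 1) :=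
          funext fun y => (hdiff n y).iteratedFDeriv_succ_apply_left'
        rw [this, fderiv_clm_apply
          (((hg _).fderiv_right (m := ∞) (by exact_mod_cast le_top)).differentiable
            (by simp)).differentiableAt (differentiableAt_const _)]
        simp
      rw [key, key]
      have h1 : ∀ t : Fin n, Equiv.swap (0 : Fin (n + 2)) 1 t.succ.succ = t.succ.succ := fun t =>
        Equiv.swap_apply_of_ne_of_ne (Fin.succ_ne_zero _) (by
          rw [← Fin.succ_zero_eq_one, Ne, Fin.succ_inj]; exact Fin.succ_ne_zero _)
      simp only [Fin.castSucc_zero, Fin.succ_zero_eq_one, h1, Equiv.swap_apply_left,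
        Equiv.swap_apply_right]
      exact ((hg _).contDiffAt.isSymmSndFDerivAt
        (by rw [minSmoothness_of_isRCLikeNormedField]; exact WithTop.coe_le_coe.2 le_top)) _ _
    | succ i =>
      rw [(hdiff (n + 1) x).iteratedFDeriv_succ_apply_left',
        (hdiff (n + 1) x).iteratedFDeriv_succ_apply_left']
      have h0 : Equiv.swap i.succ.castSucc i.succ.succ 0 = 0 :=
        Equiv.swap_apply_of_ne_of_ne (by simp [Fin.ext_iff]) (by simp [Fin.ext_iff])
      have h1 : ∀ t : Fin (n + 1), Equiv.swap i.succ.castSucc i.succ.succ t.succ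
          = (Equiv.swap i.castSucc i.succ t).succ := fun t => by
        rw [Fin.castSucc_succ, ← (Fin.succ_injective _).swap_apply]
      rw [h0]
      have h2 : Fin.tail (fun t => v (Equiv.swap i.succ.castSucc i.succ.succ t))
          = fun t => Fin.tail v (Equiv.swap i.castSucc i.succ t) := funext fun t => by
        simp only [Fin.tail, h1]
      rw [h2]
      simp_rw [ih i _ (Fin.tail v)]

/-- The iterated derivative of a smooth function is symmetric. -/
theorem iteratedFDeriv_comp_perm {f : E → F} (hf : ContDiff ℝ ∞ f) {n : ℕ} (x : E)
    (v : Fin n → E) (σ : Equiv.Perm (Fin n)) :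
    iteratedFDeriv ℝ n f x (fun t => v (σ t)) = iteratedFDeriv ℝ n f x v := by
  cases n with
  | zero => congr 1; exact Subsingleton.elim _ _
  | succ n =>
    have hσ : σ ∈ Submonoid.closure
        (Set.range fun i : Fin n => Equiv.swap i.castSucc i.succ) := by
      rw [Equiv.Perm.mclosure_swap_castSucc_succ]; trivial
    induction hσ using Submonoid.closure_induction generalizing v with
    | mem σ h => obtain ⟨i, rfl⟩ := h; exact iteratedFDeriv_comp_swap hf n i x v
    | one => rfl
    | mul σ τ _ _ hσ hτ => exact (hτ (fun t => v (σ t))).trans (hσ v)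

end Homogeneous

/-! ### Taylor expansion -/

/-- The value of the `n`-th derivative at the origin on the vectors `v`. -/
noncomputable def derivAt {d n : ℕ} (v : Fin n → Fin d → ℝ) : VField d →ₗ[ℝ] (Fin d → ℝ) where
  toFun f := iteratedFDeriv ℝ n f 0 v
  map_add' f g := by
    have := iteratedFDeriv_add_apply (𝕜 := ℝ) (i := n) (x := 0)
      (f.contDiff.of_le (by exact_mod_cast le_top)).contDiffAt
      (g.contDiff.of_le (by exact_mod_cast le_top)).contDiffAt
    exact DFunLike.congr_fun this v
  map_smul' r f := by
    have := iteratedFDeriv_const_smul_apply (𝕜 := ℝ) (i := n) (x := 0) (a := r)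
      (f.contDiff.of_le (by exact_mod_cast le_top)).contDiffAt
    exact DFunLike.congr_fun this v

theorem isFlat_iff {d k : ℕ} {f : VField d} :
    IsFlat k f ↔ ∀ n ≤ k, ∀ v : Fin n → Fin d → ℝ, derivAt v f = 0 :=
  forall₂_congr fun _ _ => ContinuousMultilinearMap.ext_iff

/-- The monomial `dx_{α₁} ⋯ dx_{αⱼ}`. -/
noncomputable def coordMonomial {d j : ℕ} (α : Fin j → Fin d) :
    Sym[ℝ]^j (Module.Dual ℝ (Fin d → ℝ)) :=
  SymmetricPower.tprod ℝ fun t => (LinearMap.proj (α t) : Module.Dual ℝ (Fin d → ℝ))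

theorem taylorJet_eq {d : ℕ} (k : ℕ) (f : VField d) :
    taylorJet k f = ∑ j ∈ Finset.range (k + 1), ∑ α : Fin j → Fin d,
      ((j.factorial : ℝ)⁻¹ • derivAt (fun t => Pi.single (α t) 1) f) ⊗ₜ[ℝ]
        DirectSum.lof ℝ ℕ (fun j => Sym[ℝ]^j (Module.Dual ℝ (Fin d → ℝ))) j (coordMonomial α) :=
  rfl

/-- Taylor expansion as a linear map. -/
noncomputable def taylorJetLin (d k : ℕ) : VField d →ₗ[ℝ] Jets (Fin d → ℝ) where
  toFun f := taylorJet k f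
  map_add' f g := by
    simp_rw [taylorJet_eq, map_add, smul_add, TensorProduct.add_tmul, Finset.sum_add_distrib]
  map_smul' r f := by
    simp_rw [taylorJet_eq, map_smul, smul_comm _ r, ← TensorProduct.smul_tmul', ← Finset.smul_sum]
    rfl

theorem taylorJetLin_apply {d k : ℕ} (f : VField d) : taylorJetLin d k f = taylorJet k f := rfl

theorem jetsTrunc_taylorJet {d k l : ℕ} (h : k ≤ l) (f : VField d) :
    jetsTrunc _ k (taylorJet l f) = taylorJet k f := by
  rw [taylorJet_eq, taylorJet_eq, map_sum]
  rw [← Finset.sum_subset (Finset.range_mono (Nat.succ_le_succ h))]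
  · refine Finset.sum_congr rfl fun j hj => ?_
    rw [map_sum]
    refine Finset.sum_congr rfl fun α _ => jetsTrunc_tmul_of_le ?_ _ _
    simpa [Nat.lt_succ_iff] using hj
  · intro j _ hj
    rw [map_sum]
    refine Finset.sum_eq_zero fun α _ => jetsTrunc_tmul_of_lt ?_ _ _
    simpa [Nat.lt_succ_iff] using hj

/-- The vector field encoded by `u ⊗ ℓ₁ ⋯ ℓⱼ` is the restriction of a multilinear map to the
diagonal. -/
theorem polyField_tmul_eq {d j : ℕ} (u : Fin d → ℝ) (ℓ : Fin j → Module.Dual ℝ (Fin d → ℝ)) :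
    ∃ M : ContinuousMultilinearMap ℝ (fun _ : Fin j => Fin d → ℝ) (Fin d → ℝ),
      (∀ v, M v = (∏ i, ℓ i (v i)) • u) ∧
      (polyField d (u ⊗ₜ DirectSum.lof ℝ ℕ (fun j => Sym[ℝ]^j (Module.Dual ℝ (Fin d → ℝ))) j
        (SymmetricPower.tprod ℝ ℓ)) : (Fin d → ℝ) → Fin d → ℝ) = fun x => M fun _ => x := by
  refine ⟨((ContinuousMultilinearMap.mkPiAlgebra ℝ (Fin j) ℝ).compContinuousLinearMap
    fun i => LinearMap.toContinuousLinearMap (ℓ i)).smulRight u, fun v => by simp, ?_⟩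
  funext x
  rw [polyField_apply, evalJet_tmul]
  simp

theorem derivAt_polyField {d j : ℕ} (u : Fin d → ℝ) (ℓ : Fin j → Module.Dual ℝ (Fin d → ℝ))
    (v : Fin j → Fin d → ℝ) :
    derivAt v (polyField d (u ⊗ₜ DirectSum.lof ℝ ℕ
      (fun j => Sym[ℝ]^j (Module.Dual ℝ (Fin d → ℝ))) j (SymmetricPower.tprod ℝ ℓ)))
      = ∑ σ : Equiv.Perm (Fin j), (∏ i, ℓ i (v (σ i))) • u := by
  obtain ⟨M, hM, hP⟩ := polyField_tmul_eq u ℓ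
  change iteratedFDeriv ℝ j _ 0 v = _
  rw [hP, M.iteratedFDeriv_comp_diagonal]
  simp_rw [hM]

theorem derivAt_polyField_of_ne {d j n : ℕ} (h : n ≠ j) (u : Fin d → ℝ)
    (ℓ : Fin j → Module.Dual ℝ (Fin d → ℝ)) (v : Fin n → Fin d → ℝ) :
    derivAt v (polyField d (u ⊗ₜ DirectSum.lof ℝ ℕ
      (fun j => Sym[ℝ]^j (Module.Dual ℝ (Fin d → ℝ))) j (SymmetricPower.tprod ℝ ℓ))) = 0 := by
  obtain ⟨M, hM, hP⟩ := polyField_tmul_eq u ℓ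
  change iteratedFDeriv ℝ n _ 0 v = _
  rw [hP, iteratedFDeriv_diagonal_of_ne h]
  rfl

theorem sum_apply_smul_proj {d : ℕ} (ℓ : Module.Dual ℝ (Fin d → ℝ)) :
    ∑ a, ℓ (Pi.single a 1) • (LinearMap.proj a : Module.Dual ℝ (Fin d → ℝ)) = ℓ := by
  refine LinearMap.pi_ext' fun i => LinearMap.ext_ring ?_
  simp [Pi.single_apply]

/-- The Taylor expansion of a polynomial vector field is its truncation. -/
theorem taylorJet_polyField {d : ℕ} (k : ℕ) (w : Jets (Fin d → ℝ)) :
    taylorJet k (polyField d w) = jetsTrunc _ k w := by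
  rw [← taylorJetLin_apply]
  induction w using jets_induction with
  | hzero => simp only [map_zero]
  | hadd x y hx hy => simp only [map_add, hx, hy]
  | hpure u j ℓ =>
    rw [taylorJetLin_apply, taylorJet_eq]
    have h0 : ∀ i ∈ Finset.range (k + 1), i ≠ j → ∑ α : Fin i → Fin d,
        ((i.factorial : ℝ)⁻¹ • derivAt (fun t => Pi.single (α t) 1) (polyField d
          (u ⊗ₜ DirectSum.lof ℝ ℕ (fun j => Sym[ℝ]^j (Module.Dual ℝ (Fin d → ℝ))) j
            (SymmetricPower.tprod ℝ ℓ)))) ⊗ₜ[ℝ] DirectSum.lof ℝ ℕ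
              (fun j => Sym[ℝ]^j (Module.Dual ℝ (Fin d → ℝ))) i (coordMonomial α) = 0 :=
      fun i _ hi => Finset.sum_eq_zero fun α _ => by
        rw [derivAt_polyField_of_ne hi, smul_zero, TensorProduct.zero_tmul]
    rcases le_or_gt j k with h | h
    · rw [jetsTrunc_tmul_of_le h, Finset.sum_eq_single j h0
        (fun hj => absurd (Finset.mem_range.2 (Nat.lt_succ_of_le h)) hj)]
      simp_rw [derivAt_polyField, ← Finset.sum_smul, smul_smul, TensorProduct.smul_tmul,
        ← map_smul]
      rw [← TensorProduct.tmul_sum, ← map_sum]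
      congr 2
      simp_rw [mul_smul, ← Finset.smul_sum, Finset.sum_smul]
      rw [Finset.sum_comm]
      -- Each of the `j!` permutations in the derivative of a monomial returns the same product, and
      -- `1 / j!` in the Taylor expansion cancels their number.
      have : ∀ σ : Equiv.Perm (Fin j), ∑ α : Fin j → Fin d,
          (∏ i, ℓ i (Pi.single (α (σ i)) 1)) • coordMonomial α = SymmetricPower.tprod ℝ ℓ :=
        fun σ => by
          rw [← SymmetricPower.tprod_equiv σ⁻¹ ℓ, ← multilinear_expand (A := fun _ => Fin d)
            (SymmetricPower.tprod ℝ) (fun _ a => LinearMap.proj a)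
            (fun i a => ℓ (σ⁻¹ i) (Pi.single a 1)) (fun i => ℓ (σ⁻¹ i))
            (fun i => sum_apply_smul_proj _)]
          refine Finset.sum_congr rfl fun α _ => ?_
          congr 1
          exact Fintype.prod_equiv σ _ _ fun i => by simp
      have hj : (j.factorial : ℝ) ≠ 0 := by exact_mod_cast j.factorial_ne_zero
      simp [this, Fintype.card_perm, ← Nat.cast_smul_eq_nsmul ℝ, smul_smul, hj]
    · rw [jetsTrunc_tmul_of_lt h]
      refine Finset.sum_eq_zero fun i hi => h0 i hi ?_
      have := Finset.mem_range.1 hi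
      omega

/-- A vector field agrees with its Taylor polynomial up to a flat remainder. -/
theorem isFlat_sub_polyField_taylorJet {d : ℕ} (k : ℕ) (f : VField d) :
    IsFlat k (f - polyField d (taylorJet k f)) := by
  rw [isFlat_iff]
  intro n hn v
  rw [map_sub, taylorJet_eq, map_sum, map_sum,
    Finset.sum_eq_single n (fun i _ hi => ?_)
      (fun h => absurd (Finset.mem_range.2 (Nat.lt_succ_of_le hn)) h)]
  · simp_rw [map_sum, coordMonomial, derivAt_polyField, LinearMap.proj_apply]
    rw [Finset.sum_comm, sub_eq_zero]
    have : ∀ σ : Equiv.Perm (Fin n), ∑ α : Fin n → Fin d,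
        (∏ i, v (σ i) (α i)) • (n.factorial : ℝ)⁻¹ • derivAt (fun t => Pi.single (α t) 1) f
          = (n.factorial : ℝ)⁻¹ • derivAt v f := fun σ => by
      -- The derivative of the Taylor polynomial is an average over all orders of the arguments; it
      -- equals that of `f` only because the latter is symmetric.
      have h1 : derivAt v f = iteratedFDeriv ℝ n f 0 fun t => v (σ t) :=
        (iteratedFDeriv_comp_perm f.contDiff 0 v σ).symm
      rw [h1]
      have h2 := multilinear_expand (A := fun _ => Fin d)
        (iteratedFDeriv ℝ n f 0).toMultilinearMap (fun _ a => Pi.single a 1)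
        (fun i a => v (σ i) a) (fun i => v (σ i)) (fun i => by
          simpa using (Pi.basisFun ℝ (Fin d)).sum_repr (v (σ i)))
      refine Eq.trans ?_ (congrArg _ h2)
      rw [Finset.smul_sum]
      exact Finset.sum_congr rfl fun α _ => smul_comm _ _ _
    have hj : (n.factorial : ℝ) ≠ 0 := by exact_mod_cast n.factorial_ne_zero
    simp_rw [this]
    rw [Finset.sum_const, Finset.card_univ, Fintype.card_perm, Fintype.card_fin,
      ← Nat.cast_smul_eq_nsmul ℝ, smul_smul, mul_inv_cancel₀ hj, one_smul]
  · rw [map_sum, map_sum]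
    exact Finset.sum_eq_zero fun α _ => derivAt_polyField_of_ne hi.symm _ _ _

theorem taylorJet_of_isFlat {d k : ℕ} {f : VField d} (h : IsFlat k f) : taylorJet k f = 0 := by
  rw [taylorJet_eq]
  refine Finset.sum_eq_zero fun j hj => Finset.sum_eq_zero fun α _ => ?_
  rw [isFlat_iff.1 h j (by simpa [Nat.lt_succ_iff] using hj), smul_zero, TensorProduct.zero_tmul]

/-! ### Jets at arbitrary points and the correspondence with linear maps -/

theorem affineAct_apply {d : ℕ} (A : GL (Fin d) ℝ) (b : Fin d → ℝ) (f : VField d)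
    (x : Fin d → ℝ) : affineAct A b f x = A.val.mulVec (f ((A⁻¹).val.mulVec (x - b))) := rfl

/-- Translation of vector fields as a linear map. -/
noncomputable def translate {d : ℕ} (b : Fin d → ℝ) : VField d →ₗ[ℝ] VField d where
  toFun f := affineAct 1 b f
  map_add' f g := VField.ext fun x => by
    rw [affineAct_one_apply]
    exact congrArg₂ (· + ·) (affineAct_one_apply b f x).symm (affineAct_one_apply b g x).symm
  map_smul' r f := VField.ext fun x => by
    rw [affineAct_one_apply]
    exact congrArg (r • ·) (affineAct_one_apply b f x).symm

theorem translate_apply {d : ℕ} (b : Fin d → ℝ) (f : VField d) : translate b f = affineAct 1 b f :=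
  rfl

theorem translate_neg_apply {d : ℕ} (x y : Fin d → ℝ) (f : VField d) :
    translate (-x) f y = f (y + x) := by
  rw [translate_apply, affineAct_one_apply, sub_neg_eq_add]

theorem translate_zero {d : ℕ} (f : VField d) : translate 0 f = f :=
  VField.ext fun y => by rw [translate_apply, affineAct_one_apply, sub_zero]

theorem translate_affineAct {d : ℕ} (A : GL (Fin d) ℝ) (b x : Fin d → ℝ) (f : VField d) :
    translate (-x) (affineAct A b f)
      = affineAct A 0 (translate (-((A⁻¹).val.mulVec (x - b))) f) :=
  VField.ext fun y => by
    rw [translate_neg_apply, affineAct_apply, affineAct_apply, translate_neg_apply, sub_zero,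
      ← Matrix.mulVec_add, add_sub_assoc]

theorem IsFlat.affineAct {d k : ℕ} {f : VField d} (h : IsFlat k f) (A : GL (Fin d) ℝ) :
    IsFlat k (affineAct A 0 f) := fun n hn => by
  let L : (Fin d → ℝ) →L[ℝ] (Fin d → ℝ) := LinearMap.toContinuousLinearMap A.val.mulVecLin
  let L' : (Fin d → ℝ) →L[ℝ] (Fin d → ℝ) := LinearMap.toContinuousLinearMap (A⁻¹).val.mulVecLin
  have h1 : (LocalEquivariant.affineAct A 0 f : (Fin d → ℝ) → Fin d → ℝ) = (L ∘ f) ∘ L' :=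
    funext fun y => by
      rw [affineAct_apply, sub_zero]; rfl
  have hf : ContDiff ℝ n f := f.contDiff.of_le (by exact_mod_cast le_top)
  rw [h1, L'.iteratedFDeriv_comp_right (L.contDiff.comp hf) _ le_rfl, map_zero,
    L.iteratedFDeriv_comp_left hf.contDiffAt le_rfl, h n hn]
  ext v
  simp

/-- Split `f` into its Taylor polynomial and a flat remainder: linear substitutions preserve
flatness, and on polynomial fields the action is the one on jets. -/
theorem taylorJet_affineAct {d : ℕ} {H : Subgroup (GL (Fin d) ℝ)} (A : H) (k : ℕ) (f : VField d) :
    taylorJet k (affineAct A.1 0 f) = jetsRep (stdRep H) A (taylorJet k f) := by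
  have h1 := taylorJet_of_isFlat ((isFlat_sub_polyField_taylorJet k f).affineAct A.1)
  have h2 : affineAct A.1 0 (f - polyField d (taylorJet k f))
      = affineAct A.1 0 f - polyField d (jetsRep (stdRep H) A (taylorJet k f)) := by
    rw [polyField_jetsRep]
    exact VField.ext fun x => Matrix.mulVec_sub A.1.val (f _) (polyField d (taylorJet k f) _)
  rw [h2, ← taylorJetLin_apply, map_sub, taylorJetLin_apply, taylorJetLin_apply,
    taylorJet_polyField, jetsTrunc_jetsRep, jetsTrunc_taylorJet le_rfl, sub_eq_zero] at h1
  exact h1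

/-- The Taylor expansion of order `k` at the point `x`. -/
noncomputable def jetAt {d : ℕ} (k : ℕ) (x : Fin d → ℝ) : VField d →ₗ[ℝ] Jets (Fin d → ℝ) :=
  taylorJetLin d k ∘ₗ translate (-x)

/-- The value at `x` of a coordinate of a partial derivative. -/
noncomputable def partialCoord {d j : ℕ} (α : Fin j → Fin d) (β : Fin d) (f : VField d)
    (x : Fin d → ℝ) : ℝ :=
  iteratedFDeriv ℝ j f x (fun t => Pi.single (α t) 1) β

/-- The indices of the partial derivatives of order at most `k` of the coordinates of a vector
field. -/
abbrev JetIndex (d k : ℕ) : Type := (Σ j : Fin (k + 1), Fin (j : ℕ) → Fin d) × Fin d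

theorem exists_jetAt_eq (d k : ℕ) : ∃ e : JetIndex d k → Jets (Fin d → ℝ),
    ∀ x f, jetAt k x f = ∑ a : JetIndex d k, partialCoord a.1.2 a.2 f x • e a := by
  refine ⟨fun a => ((a.1.1 : ℕ).factorial : ℝ)⁻¹ • (Pi.single a.2 1 ⊗ₜ[ℝ]
    DirectSum.lof ℝ ℕ (fun j => Sym[ℝ]^j (Module.Dual ℝ (Fin d → ℝ))) a.1.1
      (coordMonomial a.1.2)), fun x f => ?_⟩
  have hder : ∀ (n : ℕ) (v : Fin n → Fin d → ℝ),
      derivAt v (translate (-x) f) = iteratedFDeriv ℝ n f x v := fun n v => by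
    have : (translate (-x) f : (Fin d → ℝ) → Fin d → ℝ) = fun y => f (y + x) :=
      funext fun y => translate_neg_apply x y f
    change iteratedFDeriv ℝ n _ 0 v = _
    rw [this, iteratedFDeriv_comp_add_right, zero_add]
  have hsum : ∀ u : Fin d → ℝ, u = ∑ β, u β • (Pi.single β 1 : Fin d → ℝ) := fun u => by
    simpa using ((Pi.basisFun ℝ (Fin d)).sum_repr u).symm
  change taylorJet k (translate (-x) f) = _
  rw [taylorJet_eq, Finset.sum_range, Fintype.sum_prod_type, Fintype.sum_sigma]
  refine Finset.sum_congr rfl fun j _ => Finset.sum_congr rfl fun α _ => ?_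
  rw [hder]
  conv_lhs => rw [hsum (iteratedFDeriv ℝ j f x fun t => Pi.single (α t) 1)]
  rw [Finset.smul_sum, TensorProduct.sum_tmul]
  refine Finset.sum_congr rfl fun β _ => ?_
  rw [smul_comm, ← TensorProduct.smul_tmul', ← TensorProduct.smul_tmul']
  rfl

/-- This coordinate form, with constants `c` independent of the point, gives both smoothness of the
output and continuity of the operator. -/
theorem exists_apply_jetAt_eq {d m : ℕ} (k : ℕ) (L : Sym[ℝ]^m (Jets (Fin d → ℝ)) →ₗ[ℝ] Fin d → ℝ) :
    ∃ c : (Fin m → JetIndex d k) → Fin d → ℝ, ∀ (x : Fin d → ℝ) (f : Fin m → VField d),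
      L (SymmetricPower.tprod ℝ fun i => jetAt k x (f i))
        = ∑ a : Fin m → JetIndex d k,
          (∏ i, partialCoord (a i).1.2 (a i).2 (f i) x) • c a := by
  obtain ⟨e, he⟩ := exists_jetAt_eq d k
  refine ⟨fun a => L (SymmetricPower.tprod ℝ fun i => e (a i)), fun x f => ?_⟩
  exact (multilinear_expand (A := fun _ => JetIndex d k)
    (L.compMultilinearMap (SymmetricPower.tprod ℝ)) (fun _ => e)
    (fun i a => partialCoord a.1.2 a.2 (f i) x) (fun i => jetAt k x (f i))
    (fun i => (he x (f i)).symm)).symm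

theorem contDiff_partialCoord {d j : ℕ} (α : Fin j → Fin d) (β : Fin d) (f : VField d) :
    ContDiff ℝ ∞ (partialCoord α β f) := by
  have h : ContDiff ℝ ∞ (iteratedFDeriv ℝ j f) :=
    f.contDiff.iteratedFDeriv_right (by exact_mod_cast le_top)
  exact contDiff_pi.1 ((ContinuousMultilinearMap.apply ℝ (fun _ : Fin j => Fin d → ℝ) (Fin d → ℝ)
    fun t => Pi.single (α t) 1).contDiff.comp h) β

/-- The differential operator given by a linear map on jets. -/
noncomputable def jetOperator {d m : ℕ} (k : ℕ)
    (L : Sym[ℝ]^m (Jets (Fin d → ℝ)) →ₗ[ℝ] Fin d → ℝ) :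
    MultilinearMap ℝ (fun _ : Fin m => VField d) (VField d) where
  toFun f := ⟨fun x => L (SymmetricPower.tprod ℝ fun i => jetAt k x (f i)), by
    obtain ⟨c, hc⟩ := exists_apply_jetAt_eq k L
    have : (fun x => L (SymmetricPower.tprod ℝ fun i => jetAt k x (f i))) = fun x =>
        ∑ a : Fin m → JetIndex d k, (∏ i, partialCoord (a i).1.2 (a i).2 (f i) x) • c a :=
      funext fun x => hc x f
    change ContDiff ℝ ∞ _
    rw [this]
    exact ContDiff.sum fun a _ => (contDiff_prod fun i _ => contDiff_partialCoord _ _ _).smul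
      contDiff_const⟩
  map_update_add' f i u v := VField.ext fun x =>
    ((L.compMultilinearMap (SymmetricPower.tprod ℝ)).compLinearMap
      fun _ => jetAt k x).map_update_add f i u v
  map_update_smul' f i r u := VField.ext fun x =>
    ((L.compMultilinearMap (SymmetricPower.tprod ℝ)).compLinearMap
      fun _ => jetAt k x).map_update_smul f i r u

theorem jetOperator_apply {d m : ℕ} (k : ℕ)
    (L : Sym[ℝ]^m (Jets (Fin d → ℝ)) →ₗ[ℝ] Fin d → ℝ) (f : Fin m → VField d) (x : Fin d → ℝ) :
    jetOperator k L f x = L (SymmetricPower.tprod ℝ fun i => jetAt k x (f i)) := rfl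

theorem jetAt_zero {d : ℕ} (k : ℕ) (f : VField d) : jetAt k 0 f = taylorJet k f := by
  change taylorJet k (translate (-0) f) = _
  rw [neg_zero, translate_zero]

theorem jetAt_eq_zero {d : ℕ} (k : ℕ) {x : Fin d → ℝ} {f : VField d} (h : ∀ᶠ y in 𝓝 x, f y = 0) :
    jetAt k x f = 0 := by
  refine taylorJet_of_isFlat fun n _ => ?_
  have : (translate (-x) f : (Fin d → ℝ) → Fin d → ℝ) = fun y => f (y + x) :=
    funext fun y => translate_neg_apply x y f
  rw [this, iteratedFDeriv_comp_add_right, zero_add]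
  refine ((Filter.EventuallyEq.iteratedFDeriv ℝ (f₂ := fun _ => (0 : Fin d → ℝ)) h n).eq_of_nhds).trans ?_
  simp

/-- An affine map takes the jet at `A⁻¹ (x - b)` to the jet at `x` through the linear action of `A`
alone, so equivariance of `L` under `H` suffices. -/
theorem jetOperator_mem {d m : ℕ} {H : Subgroup (GL (Fin d) ℝ)} (k : ℕ)
    {L : Sym[ℝ]^m (Jets (Fin d → ℝ)) →ₗ[ℝ] Fin d → ℝ} (hL : L ∈ equivariantLin (stdRep H) m) :
    jetOperator k L ∈ localEquivariantMaps d H m := by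
  refine ⟨fun σ f => VField.ext fun x => ?_, fun f i => ?_, fun A hA b f => VField.ext fun x => ?_⟩
  · rw [jetOperator_apply, jetOperator_apply]
    exact congrArg L (SymmetricPower.tprod_equiv σ fun i => jetAt k x (f i))
  · refine closure_minimal (fun x hx => ?_) (isClosed_tsupport _)
    by_contra h
    refine hx ?_
    rw [jetOperator_apply, MultilinearMap.map_coord_zero _ i, map_zero]
    exact jetAt_eq_zero k (notMem_tsupport_iff_eventuallyEq.1 h)
  · have h1 : ∀ f, jetAt k x (affineAct A b f)
        = jetsRep (stdRep H) ⟨A, hA⟩ (jetAt k ((A⁻¹).val.mulVec (x - b)) f) := fun f => by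
      change taylorJet k (translate (-x) _) = jetsRep _ _ (taylorJet k (translate _ f))
      rw [translate_affineAct, ← taylorJet_affineAct ⟨A, hA⟩]
    rw [jetOperator_apply, affineAct_apply, jetOperator_apply]
    simp_rw [h1]
    have h2 := hL ⟨A, hA⟩
      (SymmetricPower.tprod ℝ fun i => jetAt k ((A⁻¹).val.mulVec (x - b)) (f i))
    change L (symMap m _ _) = _ at h2
    rw [symMap_tprod] at h2
    exact h2

theorem apply_eq_of_isFlat {d m k : ℕ}
    {φ : MultilinearMap ℝ (fun _ : Fin m => VField d) (VField d)}
    (hφ : ∀ (f : Fin m → VField d) (i : Fin m), IsFlat k (f i) → φ f 0 = 0)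
    {f g : Fin m → VField d} (h : ∀ i, IsFlat k (f i - g i)) : φ f 0 = φ g 0 := by
  classical
  have key : ∀ s : Finset (Fin m), φ (s.piecewise f g) 0 = φ g 0 := fun s => by
    induction s using Finset.induction_on with
    | empty => simp
    | insert a s ha ih =>
      rw [← ih, Finset.piecewise_insert]
      have h0 := hφ (Function.update (s.piecewise f g) a (f a - g a)) a (by
        rw [Function.update_self]; exact h a)
      rw [MultilinearMap.map_update_sub] at h0
      have h1 : Function.update (s.piecewise f g) a (g a) = s.piecewise f g := by
        rw [Function.update_eq_self_iff]
        simp [ha]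
      rw [h1] at h0
      exact sub_eq_zero.1 h0
  simpa using key Finset.univ

/-- The linear map on jets given by a symmetric operator on vector fields. -/
noncomputable def operatorSymbol {d m : ℕ}
    (φ : MultilinearMap ℝ (fun _ : Fin m => VField d) (VField d)) (hφ : IsSymmetric φ) :
    Sym[ℝ]^m (Jets (Fin d → ℝ)) →ₗ[ℝ] Fin d → ℝ :=
  evalAt 0 ∘ₗ symLift (φ.compLinearMap fun _ => polyField d) fun σ w =>
    hφ σ fun i => polyField d (w i)

theorem operatorSymbol_tprod {d m : ℕ}
    (φ : MultilinearMap ℝ (fun _ : Fin m => VField d) (VField d)) (hφ : IsSymmetric φ)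
    (w : Fin m → Jets (Fin d → ℝ)) :
    operatorSymbol φ hφ (SymmetricPower.tprod ℝ w) = φ (fun i => polyField d (w i)) 0 := by
  exact congrArg (evalAt 0) (symLift_tprod (φ.compLinearMap fun _ => polyField d)
    (fun σ w => hφ σ fun i => polyField d (w i)) w)

theorem operatorSymbol_mem {d m : ℕ} {H : Subgroup (GL (Fin d) ℝ)}
    (φ : MultilinearMap ℝ (fun _ : Fin m => VField d) (VField d)) (hφ : IsSymmetric φ)
    (hφ' : IsEquivariant H φ) : operatorSymbol φ hφ ∈ equivariantLin (stdRep H) m := fun A w => by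
  induction w using sym_induction with
  | hadd x y hx hy => simp only [map_add, hx, hy]
  | hsmul r x hx => simp only [map_smul, hx]
  | htprod w =>
    change operatorSymbol φ hφ (symMap m _ _) = _
    rw [symMap_tprod, operatorSymbol_tprod, operatorSymbol_tprod]
    simp_rw [polyField_jetsRep]
    rw [hφ' A.1 A.2, affineAct_apply]
    simp [stdRep]

theorem apply_zero_eq_operatorSymbol {d m k : ℕ}
    {φ : MultilinearMap ℝ (fun _ : Fin m => VField d) (VField d)} (hφ : IsSymmetric φ)
    (hk : ∀ (f : Fin m → VField d) (i : Fin m), IsFlat k (f i) → φ f 0 = 0)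
    (f : Fin m → VField d) :
    φ f 0 = operatorSymbol φ hφ (SymmetricPower.tprod ℝ fun i => taylorJet k (f i)) := by
  rw [operatorSymbol_tprod]
  exact apply_eq_of_isFlat hk fun i => isFlat_sub_polyField_taylorJet k (f i)

/-- A polynomial field and its truncation at order `k` differ by a field flat of order `k`, which
`φ` does not see at the origin. -/
theorem hasOrder_operatorSymbol {d m k : ℕ}
    {φ : MultilinearMap ℝ (fun _ : Fin m => VField d) (VField d)} (hφ : IsSymmetric φ)
    (hk : ∀ (f : Fin m → VField d) (i : Fin m), IsFlat k (f i) → φ f 0 = 0) :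
    HasOrder k (operatorSymbol φ hφ) := sym_ext fun w => by
  rw [LinearMap.comp_apply, symMap_tprod, operatorSymbol_tprod φ hφ w,
    apply_zero_eq_operatorSymbol hφ hk]
  simp_rw [taylorJet_polyField]

theorem IsEquivariant.translate {d m : ℕ} {H : Subgroup (GL (Fin d) ℝ)}
    {φ : MultilinearMap ℝ (fun _ : Fin m => VField d) (VField d)} (hφ : IsEquivariant H φ)
    (f : Fin m → VField d) (x : Fin d → ℝ) :
    φ f x = φ (fun i => translate (-x) (f i)) 0 := by
  have := hφ 1 H.one_mem (-x) f
  simp_rw [translate_apply]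
  rw [this, affineAct_one_apply, sub_neg_eq_add, zero_add]

/-- Local equivariant operators correspond to equivariant linear maps of finite order on jets. -/
theorem exists_localEquivariantMaps_equiv (d m : ℕ) (H : Subgroup (GL (Fin d) ℝ)) :
    ∃ J : localEquivariantMaps d H m ≃ₗ[ℝ] equivariantLinFin (stdRep H) m,
      ∀ φ : localEquivariantMaps d H m, ∃ k₀ : ℕ, ∀ k ≥ k₀, ∀ f : Fin m → VField d,
        φ.1 f 0 = (J φ).1 (SymmetricPower.tprod ℝ fun i => taylorJet k (f i)) := by
  refine exists_linearEquiv_of_rel (fun (φ : localEquivariantMaps d H m)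
      (L : equivariantLinFin (stdRep H) m) => ∃ k₀ : ℕ, ∀ k ≥ k₀, ∀ f : Fin m → VField d,
        φ.1 f 0 = L.1 (SymmetricPower.tprod ℝ fun i => taylorJet k (f i)))
    ?_ ?_ (fun φ => ?_) ?_ (fun L => ?_) ?_
  · rintro φ ψ L L' ⟨k, hk⟩ ⟨l, hl⟩
    exact ⟨max k l, fun n hn f => congrArg₂ (· + ·) (hk n (le_trans (le_max_left _ _) hn) f)
      (hl n (le_trans (le_max_right _ _) hn) f)⟩
  · rintro r φ L ⟨k, hk⟩
    exact ⟨k, fun n hn f => congrArg (r • ·) (hk n hn f)⟩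
  · obtain ⟨φ, h1, h2, h3⟩ := φ
    obtain ⟨k, hk⟩ := h2.exists_order fun b f => h3 1 H.one_mem b f
    exact ⟨⟨operatorSymbol φ h1, operatorSymbol_mem φ h1 h3, k, hasOrder_operatorSymbol h1 hk⟩, k,
      fun l hl f => apply_zero_eq_operatorSymbol h1 (fun f i hi => hk f i fun n hn =>
        hi n (hn.trans hl)) f⟩
  · rintro φ ⟨L, hL, k₁, hk₁⟩ ⟨L', hL', k₂, hk₂⟩ ⟨l₁, h₁⟩ ⟨l₂, h₂⟩
    refine Subtype.ext (sym_ext fun w => ?_)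
    obtain ⟨k, hk⟩ : ∃ k, k₁ ≤ k ∧ k₂ ≤ k ∧ l₁ ≤ k ∧ l₂ ≤ k :=
      ⟨k₁ + k₂ + l₁ + l₂, by omega, by omega, by omega, by omega⟩
    -- Both symbols are tested on polynomial fields, whose jets realise every `w` up to truncation;
    -- `k` exceeds both orders and both thresholds.
    have e₁ := h₁ k hk.2.2.1 fun i => polyField d (w i)
    have e₂ := h₂ k hk.2.2.2 fun i => polyField d (w i)
    simp only [taylorJet_polyField] at e₁ e₂
    rw [(hk₁.mono hk.1).apply_tprod] at e₁
    rw [(hk₂.mono hk.2.1).apply_tprod] at e₂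
    exact e₁.symm.trans e₂
  · obtain ⟨L, hL, k, hk⟩ := L
    refine ⟨⟨jetOperator k L, jetOperator_mem k hL⟩, k, fun l hl f => ?_⟩
    change jetOperator k L f 0 = _
    simp_rw [jetOperator_apply, jetAt_zero, ← jetsTrunc_taylorJet hl]
    exact hk.apply_tprod _
  · rintro ⟨φ, h1, h2, h3⟩ ⟨φ', h1', h2', h3'⟩ L ⟨k, hk⟩ ⟨l, hl⟩
    refine Subtype.ext (MultilinearMap.ext fun f => VField.ext fun x => ?_)
    change φ f x = φ' f x
    -- The relation only concerns the origin; translation equivariance moves every point there.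
    rw [h3.translate, h3'.translate]
    exact (hk (max k l) (le_max_left _ _) _).trans (hl (max k l) (le_max_right _ _) _).symm

theorem exists_eq_jetOperator {d m : ℕ} {H : Subgroup (GL (Fin d) ℝ)}
    {φ : MultilinearMap ℝ (fun _ : Fin m => VField d) (VField d)}
    (hφ : φ ∈ localEquivariantMaps d H m) : ∃ k L, φ = jetOperator k L := by
  obtain ⟨h1, h2, h3⟩ := hφ
  obtain ⟨k, hk⟩ := h2.exists_order fun b f => h3 1 H.one_mem b f
  refine ⟨k, operatorSymbol φ h1, MultilinearMap.ext fun f => VField.ext fun x => ?_⟩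
  rw [h3.translate, apply_zero_eq_operatorSymbol h1 hk]
  rfl

/-! ### Continuity -/

/-- A family of smooth functions all of whose derivatives depend continuously on the parameter
and the point. -/
structure JointlySmooth {X E F : Type} [TopologicalSpace X] [NormedAddCommGroup E]
    [NormedSpace ℝ E] [NormedAddCommGroup F] [NormedSpace ℝ F] (Φ : X → E → F) : Prop where
  contDiff : ∀ x, ContDiff ℝ ∞ (Φ x)
  continuous : ∀ n, Continuous fun q : X × E => iteratedFDeriv ℝ n (Φ q.1) q.2

namespace JointlySmooth

variable {X E F G K : Type} [TopologicalSpace X] [NormedAddCommGroup E] [NormedSpace ℝ E]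
  [NormedAddCommGroup F] [NormedSpace ℝ F] [NormedAddCommGroup G] [NormedSpace ℝ G]
  [NormedAddCommGroup K] [NormedSpace ℝ K]

theorem continuous_uncurry {Φ : X → E → F} (h : JointlySmooth Φ) :
    Continuous fun q : X × E => Φ q.1 q.2 := by
  have := (continuousMultilinearCurryFin0 ℝ E F).continuous.comp (h.continuous 0)
  exact this

theorem fderiv {Φ : X → E → F} (h : JointlySmooth Φ) :
    JointlySmooth fun x => fderiv ℝ (Φ x) where
  contDiff x := (h.contDiff x).fderiv_right (by exact_mod_cast le_top)
  continuous n := by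
    have := (continuousMultilinearCurryRightEquiv' ℝ n E F).continuous.comp (h.continuous (n + 1))
    refine this.congr fun q => ?_
    simp [iteratedFDeriv_succ_eq_comp_right]

theorem clm_comp {Φ : X → E → F} (h : JointlySmooth Φ) (L : F →L[ℝ] G) :
    JointlySmooth fun x p => L (Φ x p) where
  contDiff x := L.contDiff.comp (h.contDiff x)
  continuous n := by
    have := (ContinuousLinearMap.compContinuousMultilinearMapL ℝ (fun _ : Fin n => E) F G
      L).continuous.comp (h.continuous n)
    refine this.congr fun q => ?_
    exact (L.iteratedFDeriv_comp_left (h.contDiff q.1).contDiffAt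
      (by exact_mod_cast le_top)).symm

theorem iteratedFDeriv {Φ : X → E → F} (h : JointlySmooth Φ) (j : ℕ) :
    JointlySmooth fun x => iteratedFDeriv ℝ j (Φ x) := by
  induction j with
  | zero =>
    exact h.clm_comp
      (continuousMultilinearCurryFin0 ℝ E F).symm.toContinuousLinearEquiv.toContinuousLinearMap
  | succ j ih =>
    exact ih.fderiv.clm_comp (continuousMultilinearCurryLeftEquiv ℝ
      (fun _ : Fin (j + 1) => E) F).symm.toContinuousLinearEquiv.toContinuousLinearMap

theorem const (c : F) : JointlySmooth fun (_ : X) (_ : E) => c where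
  contDiff _ := contDiff_const
  continuous n := ((contDiff_const (n := ∞) (𝕜 := ℝ)
    (c := c)).continuous_iteratedFDeriv (by exact_mod_cast le_top)).comp continuous_snd

theorem add {Φ Ψ : X → E → F} (h : JointlySmooth Φ) (h' : JointlySmooth Ψ) :
    JointlySmooth fun x p => Φ x p + Ψ x p where
  contDiff x := (h.contDiff x).add (h'.contDiff x)
  continuous n := by
    refine ((h.continuous n).add (h'.continuous n)).congr fun q => ?_
    exact (iteratedFDeriv_add_apply ((h.contDiff q.1).of_le (by exact_mod_cast le_top)).contDiffAt
      ((h'.contDiff q.1).of_le (by exact_mod_cast le_top)).contDiffAt).symm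

theorem sum {ι : Type} (s : Finset ι) {Φ : ι → X → E → F} (h : ∀ i ∈ s, JointlySmooth (Φ i)) :
    JointlySmooth fun x p => ∑ i ∈ s, Φ i x p := by
  classical
  induction s using Finset.induction_on with
  | empty => simpa using const 0
  | insert a s ha ih =>
    simp_rw [Finset.sum_insert ha]
    exact (h a (by simp)).add (ih fun i hi => h i (by simp [hi]))

theorem contDiff_bilinear (B : F →L[ℝ] G →L[ℝ] K) {Φ : X → E → F} {Ψ : X → E → G}
    (h : JointlySmooth Φ) (h' : JointlySmooth Ψ) (x : X) :
    ContDiff ℝ ∞ fun p => B (Φ x p) (Ψ x p) :=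
  B.isBoundedBilinearMap.contDiff.comp ((h.contDiff x).prodMk (h'.contDiff x))

/-- Induction on `n`: the derivative of `B (Φ, Ψ)` is a sum of two bilinear expressions in `Φ`, `Ψ`
and their first derivatives. These take values in other spaces, so the spaces and `B` are quantified
inside the induction. -/
theorem continuous_bilinear (n : ℕ) : ∀ {F G K : Type} [NormedAddCommGroup F] [NormedSpace ℝ F]
    [NormedAddCommGroup G] [NormedSpace ℝ G] [NormedAddCommGroup K] [NormedSpace ℝ K]
    (B : F →L[ℝ] G →L[ℝ] K) {Φ : X → E → F} {Ψ : X → E → G}, JointlySmooth Φ → JointlySmooth Ψ →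
      Continuous fun q : X × E => _root_.iteratedFDeriv ℝ n (fun p => B (Φ q.1 p) (Ψ q.1 p)) q.2 := by
  induction n with
  | zero =>
    intro F G K _ _ _ _ _ _ B Φ Ψ h h'
    exact (continuousMultilinearCurryFin0 ℝ E K).symm.continuous.comp
      ((B.continuous.comp h.continuous_uncurry).clm_apply h'.continuous_uncurry)
  | succ n ih =>
    intro F G K _ _ _ _ _ _ B Φ Ψ h h'
    have h1 := (ih (B.precompR E) h h'.fderiv).add (ih (B.precompL E) h.fderiv h')
    refine ((continuousMultilinearCurryRightEquiv' ℝ n E K).symm.continuous.comp h1).congr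
      fun q => ?_
    rw [iteratedFDeriv_succ_eq_comp_right]
    refine congrArg (continuousMultilinearCurryRightEquiv' ℝ n E K).symm ?_
    rw [Pi.add_apply]
    rw [← iteratedFDeriv_add_apply
      ((contDiff_bilinear _ h h'.fderiv q.1).of_le (by exact_mod_cast le_top)).contDiffAt
      ((contDiff_bilinear _ h.fderiv h' q.1).of_le (by exact_mod_cast le_top)).contDiffAt]
    congr 1
    funext p
    exact (B.fderiv_of_bilinear
      ((h.contDiff q.1).differentiable (by simp)).differentiableAt
      ((h'.contDiff q.1).differentiable (by simp)).differentiableAt).symm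

theorem bilinear (B : F →L[ℝ] G →L[ℝ] K) {Φ : X → E → F} {Ψ : X → E → G} (h : JointlySmooth Φ)
    (h' : JointlySmooth Ψ) : JointlySmooth fun x p => B (Φ x p) (Ψ x p) where
  contDiff := contDiff_bilinear B h h'
  continuous n := continuous_bilinear n B h h'

theorem prod {ι : Type} (s : Finset ι) {Φ : ι → X → E → ℝ} (h : ∀ i ∈ s, JointlySmooth (Φ i)) :
    JointlySmooth fun x p => ∏ i ∈ s, Φ i x p := by
  classical
  induction s using Finset.induction_on with
  | empty => simpa using const 1
  | insert a s ha ih =>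
    simp_rw [Finset.prod_insert ha]
    exact (h a (by simp)).bilinear (ContinuousLinearMap.mul ℝ ℝ) (ih fun i hi => h i (by simp [hi]))

end JointlySmooth

/-- Evaluation of continuous maps is jointly continuous on the locally compact space `ℝ^d`; this is
how the Fréchet topology enters. -/
theorem jointlySmooth_vfield (d : ℕ) : JointlySmooth fun f : VField d => (f : (Fin d → ℝ) → _) where
  contDiff f := f.contDiff
  continuous n := by
    have h : Continuous fun f : VField d => (⟨iteratedFDeriv ℝ n f,
        f.contDiff.continuous_iteratedFDeriv (by exact_mod_cast le_top)⟩ :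
      C(Fin d → ℝ, (Fin d → ℝ)[×n]→L[ℝ] (Fin d → ℝ))) :=
      continuous_iff_le_induced.2 (iInf_le _ n)
    exact (h.comp continuous_fst).eval continuous_snd

theorem JointlySmooth.comp_continuous {X Y E F : Type} [TopologicalSpace X] [TopologicalSpace Y]
    [NormedAddCommGroup E] [NormedSpace ℝ E] [NormedAddCommGroup F] [NormedSpace ℝ F]
    {Φ : Y → E → F} (h : JointlySmooth Φ) {u : X → Y} (hu : Continuous u) :
    JointlySmooth fun x => Φ (u x) where
  contDiff x := h.contDiff (u x)
  continuous n := (h.continuous n).comp (hu.prodMap continuous_id)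

/-- Currying turns joint continuity of each derivative into continuity for the compact-open
topologies that induce the topology of `VField d`. -/
theorem continuous_of_jointlySmooth {X : Type} [TopologicalSpace X] {d : ℕ} {Φ : X → VField d}
    (h : JointlySmooth fun x => (Φ x : (Fin d → ℝ) → Fin d → ℝ)) : Continuous Φ :=
  continuous_iInf_rng.2 fun n => continuous_induced_rng.2
    (ContinuousMap.continuous_of_continuous_uncurry _ (h.continuous n))

theorem jointlySmooth_partialCoord {d j : ℕ} (α : Fin j → Fin d) (β : Fin d) :
    JointlySmooth fun f : VField d => partialCoord α β f :=
  ((jointlySmooth_vfield d).iteratedFDeriv j).clm_comp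
    ((ContinuousLinearMap.proj β).comp
      (ContinuousMultilinearMap.apply ℝ (fun _ : Fin j => Fin d → ℝ) (Fin d → ℝ)
        fun t => Pi.single (α t) 1))

/-- Differential operators with constant coefficients are continuous. -/
theorem continuous_jetOperator {d m : ℕ} (k : ℕ)
    (L : Sym[ℝ]^m (Jets (Fin d → ℝ)) →ₗ[ℝ] Fin d → ℝ) :
    Continuous fun f : Fin m → VField d => jetOperator k L f := by
  obtain ⟨c, hc⟩ := exists_apply_jetAt_eq k L
  refine continuous_of_jointlySmooth ?_
  have : (fun f : Fin m → VField d => (jetOperator k L f : (Fin d → ℝ) → Fin d → ℝ)) =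
      fun f x => ∑ a : Fin m → JetIndex d k,
        (∏ i, partialCoord (a i).1.2 (a i).2 (f i) x) • c a :=
    funext fun f => funext fun x => hc x f
  rw [this]
  refine JointlySmooth.sum _ fun a _ => JointlySmooth.bilinear (ContinuousLinearMap.lsmul ℝ ℝ)
    (JointlySmooth.prod _ fun i _ => ?_) (JointlySmooth.const (c a))
  exact (jointlySmooth_partialCoord (a i).1.2 (a i).2).comp_continuous (continuous_apply i)

end LocalEquivariant

/-! ### The main theorem -/

theorem mainTheorem8 (d m : ℕ) (H : Subgroup (GL (Fin d) ℝ)) :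
    -- local equivariant symmetric multilinear maps are continuous for the Fréchet topology
    (∀ φ ∈ localEquivariantMaps d H m, Continuous fun f : Fin m → VField d => φ f) ∧
    -- they correspond to equivariant linear maps of finite order on `Sym^m (E ⊗ Sym M*)`
    (∃ J : localEquivariantMaps d H m ≃ₗ[ℝ] equivariantLinFin (stdRep H) m,
      ∀ φ : localEquivariantMaps d H m, ∃ k₀ : ℕ, ∀ k ≥ k₀, ∀ f : Fin m → VField d,
        φ.1 f 0 = (J φ).1 (SymmetricPower.tprod ℝ fun i => taylorJet k (f i))) ∧
    -- which decompose as the direct sum of the spaces `Sym_κ^H`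
    (∃ D : equivariantLinFin (stdRep H) m ≃ₗ[ℝ]
        ⨁ κ : {κ : ℕ →₀ ℕ // κ.degree = m}, symCompInvariants (stdRep H) κ.1,
      ∀ (L : equivariantLinFin (stdRep H) m) (κ : {κ : ℕ →₀ ℕ // κ.degree = m}),
        HasComponent L.1 κ.1 (D L κ).1) ∧
    -- without the restriction on the order, the direct product appears instead
    (∃ D : equivariantLin (stdRep H) m ≃ₗ[ℝ]
        ((κ : {κ : ℕ →₀ ℕ // κ.degree = m}) → symCompInvariants (stdRep H) κ.1),
      ∀ (L : equivariantLin (stdRep H) m) (κ : {κ : ℕ →₀ ℕ // κ.degree = m}),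
        HasComponent L.1 κ.1 (D L κ).1) := by
  refine ⟨fun φ hφ => ?_, exists_localEquivariantMaps_equiv d m H,
    exists_equivariantLinFin_equiv_directSum (stdRep H) m,
    exists_equivariantLin_equiv_pi (stdRep H) m⟩
  -- Continuity is a consequence of finite order: `φ` is a differential operator given by its
  -- symbol.
  obtain ⟨k, L, rfl⟩ := exists_eq_jetOperator hφ
  exact continuous_jetOperator k L
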